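/- Let $0<\gamma\le\infty$ and $I=[0,\gamma)$ with Lebesgue measure $m$. Let $\varphi:[0,\infty)\to[0,\infty)$ be an Orlicz function, that is, a convex function with $\varphi(0)=0$ that is not identically zero. Let $w$ be a weight function on $I$: a positive (finite for $t>0$), non-increasing function with $\int_0^t w<\infty$ for all $t\in I$ and, if $\gamma=\infty$, $\int_0^\infty w=\infty$. For a measurable $f$ on $I$ let $f^*(t)=\inf\{\lambda>0: m\{|f|>\lambda\}\le t\}$ be its decreasing rearrangement and put $\rho_{\varphi,w}(f)=\int_I\varphi(f^*)\,w\,dm$, where $\varphi(\infty)=\infty$. The Orlicz-Lorentz space $\Lambda_{\varphi,w}$ is the real Banach space of all (classes of a.e. equal) measurable functions $f$ on $I$ with $\rho_{\varphi,w}(kf)<\infty$ for some $k>0$, with the Luxemburg norm $\|f\|_{\varphi,w}=\inf\{\epsilon>0:\rho_{\varphi,w}(f/\epsilon)\le1\}$. For a real Banach space $X$ with unit ball $B_X$, unit sphere $S_X$ and dual space $X^*$, a slice of $B_X$ is a set $\{x\in B_X: x^*x>1-\alpha\}$ with $x^*\in S_{X^*}$, $\alpha>0$. The space $X$ has * the diametral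 local diameter two property (DLD2P) if for every slice $S$ of $B_X$, every $x\in S\cap S_X$ and every $\epsilon>0$ there is $y\in S$ with $\|x-y\|\ge2-\epsilon$; * the diametral diameter two property (DD2P) if for every nonempty relatively weakly open subset $V$ of $B_X$, every $x\in V\cap S_X$ and every $\epsilon>0$ there is $y\in V$ with $\|x-y\|\ge2-\epsilon$; * the Daugavet property if $\|\mathrm{Id}+T\|=1+\|T\|$ for every bounded rank-one operator $T:X\to X$, where $\mathrm{Id}$ is the identity operator. **Theorem.** If $\Lambda_{\varphi,w}$ has the DLD2P, or the DD2P, or the Daugavet property, then $\varphi$ is linear: there is $k>0$ such that $\varphi(u)=ku$ for all $u\ge0$. -/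

import Mathlib

open MeasureTheory Set Filter
open scoped ENNReal NNReal Topology

/-! ### Decreasing rearrangements -/

/-- The decreasing rearrangement `g^*(t) = inf {l > 0 : d_g(l) ≤ t}` of a function `g ≥ 0`, where
`d_g(l) = μ {g > l}`. The value `l = ∞` always competes, so the infimum is `∞` when no finite `l`
does. -/
noncomputable def decRearr {α : Type*} [MeasurableSpace α] (μ : Measure α) (g : α → ℝ≥0∞)
    (t : ℝ≥0∞) : ℝ≥0∞ :=
  sInf {l : ℝ≥0∞ | 0 < l ∧ μ {x | l < g x} ≤ t}

theorem lt_decRearr_iff {α : Type*} [MeasurableSpace α] (μ : Measure α) (g : α → ℝ≥0∞)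
    (t s : ℝ≥0∞) : s < decRearr μ g t ↔ t < μ {x | s < g x} := by
  constructor
  · intro h
    by_contra hc
    push Not at hc
    refine absurd h (not_lt.2 (le_of_forall_gt fun r hr => ?_))
    obtain ⟨q, hsq, hqr⟩ := exists_between hr
    refine lt_of_le_of_lt (sInf_le ⟨lt_of_le_of_lt (zero_le (a := s)) hsq, ?_⟩) hqr
    exact (measure_mono fun x (hx : q < g x) => hsq.trans hx).trans hc
  · intro h
    have hs : s < ∞ := by
      refine lt_of_le_of_ne le_top ?_
      rintro rfl
      simp at h
    obtain ⟨u, hu, hus, hul⟩ := exists_seq_strictAnti_tendsto' hs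
    have hU : {x | s < g x} = ⋃ n, {x | u n < g x} := by
      ext x
      simp only [mem_ofPred_eq, mem_iUnion]
      exact ⟨fun hx => ((hul.eventually (gt_mem_nhds hx)).exists),
        fun ⟨n, hn⟩ => (hus n).1.trans hn⟩
    have hM : Monotone fun n => {x | u n < g x} := fun m n hmn x (hx : u m < g x) =>
      lt_of_le_of_lt (hu.antitone hmn) hx
    rw [hU, hM.measure_iUnion] at h
    obtain ⟨n, hn⟩ := lt_iSup_iff.1 h
    refine lt_of_lt_of_le (hus n).1 (le_sInf fun l hl => ?_)
    by_contra hc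
    push Not at hc
    exact absurd (hn.trans_le ((measure_mono fun x (hx : u n < g x) => hc.trans hx).trans hl.2))
      (lt_irrefl _)

theorem decRearr_antitone {α : Type*} [MeasurableSpace α] (μ : Measure α) (g : α → ℝ≥0∞) :
    Antitone (decRearr μ g) := fun _ _ h =>
  sInf_le_sInf fun _ hl => ⟨hl.1, hl.2.trans h⟩

theorem decRearr_mono {α : Type*} [MeasurableSpace α] (μ : Measure α) {g h : α → ℝ≥0∞}
    (hgh : g ≤ᵐ[μ] h) (t : ℝ≥0∞) : decRearr μ g t ≤ decRearr μ h t := by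
  refine le_of_forall_lt fun s hs => ?_
  rw [lt_decRearr_iff] at hs ⊢
  refine hs.trans_le (measure_mono_ae ?_)
  filter_upwards [hgh] with x hx (hxs : s < g x) using lt_of_lt_of_le hxs hx

/-- Rearrangement commutes with a function whose strict superlevel sets are half lines. -/
theorem decRearr_comp {α : Type*} [MeasurableSpace α] (μ : Measure α) (g : α → ℝ≥0∞)
    {ψ : ℝ≥0∞ → ℝ≥0∞} (hψ : ∀ s < ∞, ∃ c, ∀ u, s < ψ u ↔ c < u) (t : ℝ≥0∞) :
    decRearr μ (fun x => ψ (g x)) t = ψ (decRearr μ g t) := by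
  refine eq_of_forall_lt_iff fun s => ?_
  rcases eq_or_ne s ∞ with rfl | hs
  · simp
  obtain ⟨c, hc⟩ := hψ s (lt_top_iff_ne_top.2 hs)
  simp only [lt_decRearr_iff, hc]

theorem lintegral_Ioi_indicator (a : ℝ≥0∞) :
    ∫⁻ s in Ioi (0 : ℝ), (if ENNReal.ofReal s < a then 1 else 0) = a := by
  have h1 : ∫⁻ s in Ioi (0 : ℝ), (if ENNReal.ofReal s < a then (1 : ℝ≥0∞) else 0)
      = volume ({s : ℝ | ENNReal.ofReal s < a} ∩ Ioi 0) := by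
    have hm : MeasurableSet {s : ℝ | ENNReal.ofReal s < a} :=
      measurableSet_lt ENNReal.measurable_ofReal measurable_const
    rw [← Measure.restrict_apply hm, ← lintegral_indicator_one hm]
    exact lintegral_congr fun s => by simp [indicator]
  rw [h1]
  rcases eq_or_ne a ∞ with rfl | ha
  · have : {s : ℝ | ENNReal.ofReal s < ∞} ∩ Ioi 0 = Ioi 0 := by ext; simp
    rw [this, Real.volume_Ioi]
  · have : {s : ℝ | ENNReal.ofReal s < a} ∩ Ioi 0 = Ioo 0 a.toReal := by
      ext s
      simp only [mem_inter_iff, mem_ofPred_eq, mem_Ioi, mem_Ioo]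
      constructor
      · rintro ⟨h, h0⟩
        exact ⟨h0, (ENNReal.ofReal_lt_iff_lt_toReal h0.le ha).1 h⟩
      · rintro ⟨h0, h⟩
        exact ⟨(ENNReal.ofReal_lt_iff_lt_toReal h0.le ha).2 h, h0⟩
    rw [this, Real.volume_Ioo, sub_zero, ENNReal.ofReal_toReal ha]

theorem lintegral_eq_distribution {α : Type*} [MeasurableSpace α] (μ : Measure α) [SFinite μ]
    {g : α → ℝ≥0∞} (hg : AEMeasurable g μ) :
    ∫⁻ x, g x ∂μ = ∫⁻ s in Ioi (0 : ℝ), μ {x | ENNReal.ofReal s < g x} := by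
  have hN : NullMeasurableSet {p : α × ℝ | ENNReal.ofReal p.2 < g p.1}
      (μ.prod (volume.restrict (Ioi (0 : ℝ)))) := by
    refine nullMeasurableSet_lt ?_ ?_
    · exact (ENNReal.measurable_ofReal.comp measurable_snd).aemeasurable
    · exact hg.comp_quasiMeasurePreserving Measure.quasiMeasurePreserving_fst
  have hsw := lintegral_lintegral_swap (μ := μ) (ν := volume.restrict (Ioi (0 : ℝ)))
    (f := fun x s => if ENNReal.ofReal s < g x then (1 : ℝ≥0∞) else 0) (by
      refine ((aemeasurable_const (b := (1 : ℝ≥0∞))).indicator₀ hN).congr (ae_of_all _ ?_)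
      rintro ⟨x, s⟩
      simp [indicator, Function.uncurry])
  simp only [lintegral_Ioi_indicator] at hsw
  rw [hsw]
  refine lintegral_congr fun s => ?_
  have hm : NullMeasurableSet {x | ENNReal.ofReal s < g x} μ :=
    nullMeasurableSet_lt aemeasurable_const hg
  rw [← lintegral_indicator_one₀ hm]
  exact lintegral_congr fun x => by simp [indicator]

theorem measurable_decRearr {α : Type*} [MeasurableSpace α] (μ : Measure α) (g : α → ℝ≥0∞) :
    Measurable fun t : ℝ => decRearr μ g (ENNReal.ofReal t) :=
  Antitone.measurable fun _ _ h => decRearr_antitone μ g (ENNReal.ofReal_le_ofReal h)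

theorem lintegral_decRearr_tsub {α : Type*} [MeasurableSpace α] (μ : Measure α) [SFinite μ]
    {g : α → ℝ≥0∞} (hg : AEMeasurable g μ) (l : ℝ≥0∞) :
    ∫⁻ t in Ioi (0 : ℝ), (decRearr μ g (ENNReal.ofReal t) - l) = ∫⁻ x, (g x - l) ∂μ := by
  rw [lintegral_eq_distribution μ (g := fun x => g x - l) (hg.sub aemeasurable_const),
    lintegral_eq_distribution _ (g := fun t => decRearr μ g (ENNReal.ofReal t) - l)
      ((measurable_decRearr μ g).sub measurable_const).aemeasurable]
  refine lintegral_congr fun s => ?_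
  simp only [lt_tsub_iff_left, lt_decRearr_iff]
  have hm : MeasurableSet {t : ℝ | ENNReal.ofReal t < μ {x | l + ENNReal.ofReal s < g x}} :=
    measurableSet_lt ENNReal.measurable_ofReal measurable_const
  rw [← lintegral_indicator_one hm]
  refine Eq.trans ?_ (lintegral_Ioi_indicator (μ {x | l + ENNReal.ofReal s < g x}))
  exact lintegral_congr fun t => by simp [indicator]

/-- Subadditivity of the integral of the rearrangement over an initial segment. -/
theorem lintegral_decRearr_add_le {α : Type*} [MeasurableSpace α] (μ : Measure α) [SFinite μ]
    {g h : α → ℝ≥0∞} (hg : AEMeasurable g μ) (hh : AEMeasurable h μ) {A : Set ℝ}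
    (hA : MeasurableSet A) (hA0 : A ⊆ Ioi 0) (hAl : ∀ t ∈ A, ∀ s, 0 < s → s ≤ t → s ∈ A) :
    ∫⁻ t in A, decRearr μ (fun x => g x + h x) (ENNReal.ofReal t)
      ≤ (∫⁻ t in A, decRearr μ g (ENNReal.ofReal t))
        + ∫⁻ t in A, decRearr μ h (ENNReal.ofReal t) := by
  have hup : ∀ f : α → ℝ≥0∞, AEMeasurable f μ → ∀ l : ℝ≥0∞,
      ∫⁻ t in A, decRearr μ f (ENNReal.ofReal t) ≤ (∫⁻ x, (f x - l) ∂μ) + l * volume A := by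
    intro f hf l
    rw [← lintegral_decRearr_tsub μ hf]
    calc ∫⁻ t in A, decRearr μ f (ENNReal.ofReal t)
        ≤ ∫⁻ t in A, ((decRearr μ f (ENNReal.ofReal t) - l) + l) :=
          lintegral_mono fun t => le_tsub_add
      _ = (∫⁻ t in A, (decRearr μ f (ENNReal.ofReal t) - l)) + l * volume A := by
          rw [lintegral_add_right _ measurable_const, setLIntegral_const]
      _ ≤ _ := by gcongr
  have hlow : ∀ f : α → ℝ≥0∞, AEMeasurable f μ → ∃ l : ℝ≥0∞,
      ∫⁻ t in A, decRearr μ f (ENNReal.ofReal t) = (∫⁻ x, (f x - l) ∂μ) + l * volume A := by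
    intro f hf
    set l : ℝ≥0∞ := ⨆ t ∈ Ioi (0 : ℝ) \ A, decRearr μ f (ENNReal.ofReal t) with hl
    refine ⟨l, ?_⟩
    have h1 : ∀ t ∈ Ioi (0 : ℝ) \ A, decRearr μ f (ENNReal.ofReal t) - l = 0 := fun t ht =>
      tsub_eq_zero_of_le (le_iSup₂ (f := fun (t : ℝ) (_ : t ∈ Ioi (0 : ℝ) \ A) =>
        decRearr μ f (ENNReal.ofReal t)) t ht)
    have h2 : ∀ t ∈ A, l ≤ decRearr μ f (ENNReal.ofReal t) := by
      intro t ht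
      refine iSup₂_le fun s hs => decRearr_antitone μ f (ENNReal.ofReal_le_ofReal ?_)
      by_contra hc
      push Not at hc
      exact hs.2 (hAl t ht s hs.1 hc.le)
    rw [← lintegral_decRearr_tsub μ hf, ← lintegral_inter_add_sdiff _ (Ioi (0 : ℝ)) hA,
      inter_eq_self_of_subset_right hA0,
      setLIntegral_congr_fun (measurableSet_Ioi.diff hA) h1, lintegral_zero, add_zero,
      ← setLIntegral_const, ← lintegral_add_right _ measurable_const]
    exact setLIntegral_congr_fun hA fun t ht => (tsub_add_cancel_of_le (h2 t ht)).symm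
  obtain ⟨l₁, h₁⟩ := hlow g hg
  obtain ⟨l₂, h₂⟩ := hlow h hh
  rw [h₁, h₂]
  refine (hup _ (hg.add hh) (l₁ + l₂)).trans ?_
  calc (∫⁻ x, (g x + h x - (l₁ + l₂)) ∂μ) + (l₁ + l₂) * volume A
      ≤ (∫⁻ x, ((g x - l₁) + (h x - l₂)) ∂μ) + (l₁ + l₂) * volume A := by
        gcongr ?_ + _
        refine lintegral_mono fun x => ?_
        exact add_tsub_add_le_tsub_add_tsub
    _ = _ := by
        rw [lintegral_add_left' (f := fun x => g x - l₁) (hg.sub aemeasurable_const)]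
        ring

/-! ### Orlicz functions and weights -/

/-- An Orlicz function: a convex `φ : [0, ∞) → [0, ∞)`, not identically zero, with `φ 0 = 0`. -/
structure OrliczFunction where
  toFun : ℝ≥0 → ℝ≥0
  convexOn : ConvexOn ℝ≥0 univ toFun
  map_zero : toFun 0 = 0
  ne_zero : ∃ u, toFun u ≠ 0

/-- The interval `I = [0, γ)`, with `0 ≤ γ ≤ ∞`. -/
def orliczInterval (γ : ℝ≥0∞) : Set ℝ := {t | 0 ≤ t ∧ ENNReal.ofReal t < γ}

/-- Lebesgue measure on `I = [0, γ)`. -/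
noncomputable def orliczMeasure (γ : ℝ≥0∞) : Measure ℝ := volume.restrict (orliczInterval γ)

/-- A weight function on `I = [0, γ)`: positive, decreasing (in the wide sense), integrable over
`[0, t)` for every `t` in `I`, and with infinite integral if `γ = ∞`. It may be unbounded near `0`,
so its value at the single point `0` is left free. -/
structure WeightFunction (γ : ℝ≥0∞) where
  toFun : ℝ → ℝ
  pos : ∀ t ∈ orliczInterval γ, 0 < t → 0 < toFun t
  antitoneOn : AntitoneOn toFun (orliczInterval γ ∩ Ioi 0)
  integrableOn : ∀ t ∈ orliczInterval γ, IntegrableOn toFun (Ico 0 t)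
  lintegral_eq_top : γ = ∞ → ∫⁻ t in Ici (0 : ℝ), ENNReal.ofReal (toFun t) = ∞

theorem measurableSet_orliczInterval (γ : ℝ≥0∞) : MeasurableSet (orliczInterval γ) :=
  measurableSet_Ici.inter (measurableSet_lt ENNReal.measurable_ofReal measurable_const)

/-- The extension of an Orlicz function to `[0, ∞]` by `φ(∞) = ∞`. -/
noncomputable def OrliczFunction.ext (φ : OrliczFunction) (u : ℝ≥0∞) : ℝ≥0∞ :=
  if u = ∞ then ∞ else (φ.toFun u.toNNReal : ℝ≥0∞)

/-- The modular `ρ(f) = ∫_I φ(f^*) w`. -/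
noncomputable def orliczModular {γ : ℝ≥0∞} (φ : OrliczFunction) (w : WeightFunction γ)
    (f : ℝ → ℝ) : ℝ≥0∞ :=
  ∫⁻ t in orliczInterval γ,
    φ.ext (decRearr (orliczMeasure γ) (fun x => ‖f x‖ₑ) (ENNReal.ofReal t)) *
      ENNReal.ofReal (w.toFun t)

/-! ### Convexity of the modular -/

theorem lintegral_weight_eq {γ : ℝ≥0∞} (w : WeightFunction γ) {F : ℝ → ℝ≥0∞}
    (hF : Measurable F) :
    ∫⁻ t in orliczInterval γ, F t * ENNReal.ofReal (w.toFun t) =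
      ∫⁻ s in Ioi (0 : ℝ), ∫⁻ t in {t ∈ orliczInterval γ ∩ Ioi 0 |
        ENNReal.ofReal s < ENNReal.ofReal (w.toFun t)}, F t := by
  have hI := measurableSet_orliczInterval γ
  have hK : MeasurableSet (orliczInterval γ ∩ Ioi 0) := hI.inter measurableSet_Ioi
  have hIK : (orliczInterval γ ∩ Ioi 0 : Set ℝ) =ᵐ[volume] orliczInterval γ := by
    refine (ae_eq_set_inter (ae_eq_refl _) Ioi_ae_eq_Ici).trans (ae_of_all _ fun t => ?_)
    exact propext ⟨fun h => h.1, fun h => ⟨h, h.1⟩⟩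
  have hw : AEMeasurable w.toFun (volume.restrict (orliczInterval γ ∩ Ioi 0)) :=
    aemeasurable_restrict_of_antitoneOn hK w.antitoneOn
  have hN : NullMeasurableSet
      {p : ℝ × ℝ | ENNReal.ofReal p.2 < ENNReal.ofReal (w.toFun p.1)}
      ((volume.restrict (orliczInterval γ ∩ Ioi 0)).prod (volume.restrict (Ioi (0 : ℝ)))) :=
    nullMeasurableSet_lt (ENNReal.measurable_ofReal.comp measurable_snd).aemeasurable
      (hw.ennreal_ofReal.comp_quasiMeasurePreserving Measure.quasiMeasurePreserving_fst)
  rw [← setLIntegral_congr hIK]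
  have hsw := lintegral_lintegral_swap (μ := volume.restrict (orliczInterval γ ∩ Ioi 0))
    (ν := volume.restrict (Ioi (0 : ℝ)))
    (f := fun t s => F t *
      if ENNReal.ofReal s < ENNReal.ofReal (w.toFun t) then (1 : ℝ≥0∞) else 0) (by
      refine AEMeasurable.mul (hF.comp measurable_fst).aemeasurable ?_
      refine ((aemeasurable_const (b := (1 : ℝ≥0∞))).indicator₀ hN).congr (ae_of_all _ ?_)
      rintro ⟨x, s⟩
      simp [indicator])
  have hin : ∀ t, ∫⁻ s in Ioi (0 : ℝ), F t *
      (if ENNReal.ofReal s < ENNReal.ofReal (w.toFun t) then (1 : ℝ≥0∞) else 0) =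
      F t * ENNReal.ofReal (w.toFun t) := by
    intro t
    rw [lintegral_const_mul, lintegral_Ioi_indicator]
    exact Measurable.ite (measurableSet_lt ENNReal.measurable_ofReal measurable_const)
      measurable_const measurable_const
  simp only [hin] at hsw
  rw [hsw]
  refine lintegral_congr fun s => ?_
  have hm : NullMeasurableSet {t | ENNReal.ofReal s < ENNReal.ofReal (w.toFun t)}
      (volume.restrict (orliczInterval γ ∩ Ioi 0)) :=
    nullMeasurableSet_lt aemeasurable_const hw.ennreal_ofReal
  have h2 : {t ∈ orliczInterval γ ∩ Ioi 0 | ENNReal.ofReal s < ENNReal.ofReal (w.toFun t)} =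
      {t | ENNReal.ofReal s < ENNReal.ofReal (w.toFun t)} ∩ (orliczInterval γ ∩ Ioi 0) := by
    ext; simp [and_comm]
  rw [h2, ← Measure.restrict_restrict₀ hm, ← lintegral_indicator₀ hm]
  exact lintegral_congr fun t => by simp [indicator]

instance (γ : ℝ≥0∞) : SFinite (orliczMeasure γ) := by
  unfold orliczMeasure; infer_instance

/-- Subadditivity of the Lorentz functional `g ↦ ∫_I g^* w`. -/
theorem lintegral_decRearr_weight_add_le {γ : ℝ≥0∞} (w : WeightFunction γ) {g h : ℝ → ℝ≥0∞}
    (hg : AEMeasurable g (orliczMeasure γ)) (hh : AEMeasurable h (orliczMeasure γ)) :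
    ∫⁻ t in orliczInterval γ, decRearr (orliczMeasure γ) (fun x => g x + h x) (ENNReal.ofReal t) *
        ENNReal.ofReal (w.toFun t) ≤
      (∫⁻ t in orliczInterval γ, decRearr (orliczMeasure γ) g (ENNReal.ofReal t) *
        ENNReal.ofReal (w.toFun t)) +
      ∫⁻ t in orliczInterval γ, decRearr (orliczMeasure γ) h (ENNReal.ofReal t) *
        ENNReal.ofReal (w.toFun t) := by
  have hK : ∀ s : ℝ, ∀ t ∈ {t ∈ orliczInterval γ ∩ Ioi 0 |
      ENNReal.ofReal s < ENNReal.ofReal (w.toFun t)}, ∀ r, 0 < r → r ≤ t →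
      r ∈ {t ∈ orliczInterval γ ∩ Ioi 0 | ENNReal.ofReal s < ENNReal.ofReal (w.toFun t)} := by
    rintro s t ⟨⟨ht, ht0⟩, hst⟩ r hr0 hrt
    have hr : r ∈ orliczInterval γ ∩ Ioi 0 :=
      ⟨⟨hr0.le, (ENNReal.ofReal_le_ofReal hrt).trans_lt ht.2⟩, hr0⟩
    exact ⟨hr, hst.trans_le (ENNReal.ofReal_le_ofReal (w.antitoneOn hr ⟨ht, ht0⟩ hrt))⟩
  have hKm : ∀ s : ℝ, MeasurableSet {t ∈ orliczInterval γ ∩ Ioi 0 |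
      ENNReal.ofReal s < ENNReal.ofReal (w.toFun t)} := by
    intro s
    refine OrdConnected.measurableSet ⟨fun a ha b hb c hc => ?_⟩
    exact hK s b hb c (lt_of_lt_of_le ha.1.2 hc.1) hc.2
  have hKs : ∀ s : ℝ, {t ∈ orliczInterval γ ∩ Ioi 0 |
      ENNReal.ofReal s < ENNReal.ofReal (w.toFun t)} ⊆ Ioi 0 := fun s t ht => ht.1.2
  rw [lintegral_weight_eq w (measurable_decRearr _ _),
    lintegral_weight_eq w (measurable_decRearr _ _),
    lintegral_weight_eq w (measurable_decRearr _ _)]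
  refine (lintegral_mono fun s =>
    lintegral_decRearr_add_le (orliczMeasure γ) hg hh (hKm s) (hKs s) (hK s)).trans ?_
  rw [lintegral_add_left]
  refine Antitone.measurable fun s r hsr => lintegral_mono_set ?_
  rintro t ⟨ht, hrt⟩
  exact ⟨ht, (ENNReal.ofReal_le_ofReal hsr).trans_lt hrt⟩

namespace OrliczFunction

theorem map_mul_le (φ : OrliczFunction) {c : ℝ≥0} (hc : c ≤ 1) (u : ℝ≥0) :
    φ.toFun (c * u) ≤ c * φ.toFun u := by
  have := φ.convexOn.2 (mem_univ u) (mem_univ 0) (zero_le (a := c)) (zero_le (a := 1 - c))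
    (add_tsub_cancel_of_le hc)
  simpa [φ.map_zero] using this

theorem mono (φ : OrliczFunction) : Monotone φ.toFun := by
  intro u v huv
  rcases eq_or_ne v 0 with rfl | hv
  · rw [le_antisymm huv (zero_le (a := u))]
  have hc : u / v ≤ 1 := div_le_one_of_le₀ huv (zero_le (a := v))
  have := φ.map_mul_le hc v
  rw [div_mul_cancel₀ u hv] at this
  exact this.trans (mul_le_of_le_one_left (zero_le (a := φ.toFun v)) hc)

theorem continuous (φ : OrliczFunction) : Continuous φ.toFun := by
  have hcv : ConvexOn ℝ univ fun x : ℝ => (φ.toFun x.toNNReal : ℝ) := by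
    refine ⟨convex_univ, fun x _ y _ a b ha hb hab => ?_⟩
    lift a to ℝ≥0 using ha
    lift b to ℝ≥0 using hb
    have hab' : a + b = 1 := by exact_mod_cast hab
    have h1 := φ.convexOn.2 (mem_univ x.toNNReal) (mem_univ y.toNNReal) (zero_le (a := a))
      (zero_le (a := b)) hab'
    have h2 : ((a : ℝ) • x + (b : ℝ) • y).toNNReal ≤ a • x.toNNReal + b • y.toNNReal := by
      refine Real.toNNReal_add_le.trans ?_
      simp [Real.toNNReal_mul]
    have h3 := (φ.mono h2).trans h1
    exact_mod_cast h3
  have hct := continuousOn_univ.1 (hcv.continuousOn isOpen_univ)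
  have h4 : Continuous fun u : ℝ≥0 => (φ.toFun ((u : ℝ).toNNReal) : ℝ) :=
    hct.comp NNReal.continuous_coe
  simp only [Real.toNNReal_coe] at h4
  exact NNReal.isEmbedding_coe.continuous_iff.2 h4

theorem exists_forall_lt (φ : OrliczFunction) (s : ℝ≥0) : ∃ v, ∀ u, v ≤ u → s < φ.toFun u := by
  obtain ⟨v, hv⟩ := φ.ne_zero
  have hv' : 0 < φ.toFun v := pos_iff_ne_zero.2 hv
  have hv0 : v ≠ 0 := fun h => hv (h ▸ φ.map_zero)
  set n : ℝ≥0 := 1 + s / φ.toFun v with hn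
  have hn1 : 1 ≤ n := le_add_of_nonneg_right (zero_le (a := s / φ.toFun v))
  have hn0 : n ≠ 0 := (lt_of_lt_of_le one_pos hn1).ne'
  refine ⟨n * v, fun u hu => lt_of_lt_of_le ?_ (φ.mono hu)⟩
  have h1 := φ.map_mul_le (c := n⁻¹) (inv_le_one_of_one_le₀ hn1) (n * v)
  rw [inv_mul_cancel_left₀ hn0] at h1
  have h2 : n * φ.toFun v ≤ φ.toFun (n * v) := by
    have := mul_le_mul_right h1 n
    rwa [mul_inv_cancel_left₀ hn0] at this
  refine lt_of_lt_of_le ?_ h2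
  rw [hn, add_mul, one_mul, div_mul_cancel₀ _ hv]
  exact lt_add_of_pos_left _ hv'

theorem ext_coe (φ : OrliczFunction) (u : ℝ≥0) : φ.ext u = φ.toFun u := by simp [ext]

theorem ext_top (φ : OrliczFunction) : φ.ext ∞ = ∞ := by simp [ext]

theorem ext_zero (φ : OrliczFunction) : φ.ext 0 = 0 := by
  simpa [φ.map_zero] using φ.ext_coe 0

theorem ext_mono (φ : OrliczFunction) : Monotone φ.ext := by
  intro u v huv
  rcases eq_or_ne v ∞ with rfl | hv
  · simp [ext_top]
  lift v to ℝ≥0 using hv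
  lift u to ℝ≥0 using ne_top_of_le_ne_top ENNReal.coe_ne_top huv
  rw [ext_coe, ext_coe]
  exact_mod_cast φ.mono (by exact_mod_cast huv)

theorem ext_convex (φ : OrliczFunction) (u v : ℝ≥0∞) {a b : ℝ≥0} (hab : a + b = 1) :
    φ.ext (a * u + b * v) ≤ a * φ.ext u + b * φ.ext v := by
  rcases eq_or_ne a 0 with rfl | ha
  · have : b = 1 := by simpa using hab
    simp [this]
  rcases eq_or_ne b 0 with rfl | hb
  · have : a = 1 := by simpa using hab
    simp [this]
  rcases eq_or_ne u ∞ with rfl | hu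
  · simp [ext_top, ENNReal.mul_top, ha]
  rcases eq_or_ne v ∞ with rfl | hv
  · simp [ext_top, ENNReal.mul_top, hb]
  lift u to ℝ≥0 using hu
  lift v to ℝ≥0 using hv
  have := φ.convexOn.2 (mem_univ u) (mem_univ v) (zero_le (a := a)) (zero_le (a := b)) hab
  rw [ext_coe, ext_coe, ← ENNReal.coe_mul, ← ENNReal.coe_mul, ← ENNReal.coe_add, ext_coe]
  exact_mod_cast this

theorem ext_superlevel (φ : OrliczFunction) (s : ℝ≥0∞) (hs : s < ∞) :
    ∃ c, ∀ u, s < φ.ext u ↔ c < u := by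
  lift s to ℝ≥0 using hs.ne
  obtain ⟨v, hv⟩ := φ.exists_forall_lt s
  have hK : IsCompact {u : ℝ≥0 | φ.toFun u ≤ s} := by
    refine isCompact_Icc.of_isClosed_subset (isClosed_le φ.continuous continuous_const)
      (fun u (hu : φ.toFun u ≤ s) => (⟨zero_le (a := u), ?_⟩ : u ∈ Icc 0 v))
    by_contra hc
    push Not at hc
    exact absurd hu (not_le.2 (hv u hc.le))
  have hmem := hK.sSup_mem ⟨0, by simp [φ.map_zero]⟩
  have hle := fun u hu => le_csSup hK.bddAbove (a := u) hu
  set c := sSup {u : ℝ≥0 | φ.toFun u ≤ s}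
  refine ⟨c, fun u => ?_⟩
  rcases eq_or_ne u ∞ with rfl | hu
  · simp [ext_top]
  lift u to ℝ≥0 using hu
  rw [ext_coe, ENNReal.coe_lt_coe, ENNReal.coe_lt_coe, ← not_le, ← not_le, not_iff_not]
  exact ⟨fun h => hle u h, fun h => (φ.mono h).trans hmem⟩

theorem ext_measurable (φ : OrliczFunction) : Measurable φ.ext := φ.ext_mono.measurable

end OrliczFunction

theorem decRearr_const_mul {α : Type*} [MeasurableSpace α] (μ : Measure α) (g : α → ℝ≥0∞)
    (a : ℝ≥0) (t : ℝ≥0∞) : decRearr μ (fun x => a * g x) t = a * decRearr μ g t := by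
  rcases eq_or_ne a 0 with rfl | ha
  · refine le_antisymm (le_of_forall_lt fun s hs => ?_) (by simp)
    rw [lt_decRearr_iff] at hs
    simp at hs
  · refine decRearr_comp μ g (ψ := fun u => a * u) (fun s _ => ⟨s / a, fun u => ?_⟩) t
    rw [ENNReal.div_lt_iff (by simp [ha]) (by simp), mul_comm]

section Modular

variable {γ : ℝ≥0∞} (φ : OrliczFunction) (w : WeightFunction γ)

theorem orliczModular_eq (f : ℝ → ℝ) :
    orliczModular φ w f = ∫⁻ t in orliczInterval γ,
      decRearr (orliczMeasure γ) (fun x => φ.ext ‖f x‖ₑ) (ENNReal.ofReal t) *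
        ENNReal.ofReal (w.toFun t) := by
  unfold orliczModular
  refine lintegral_congr fun t => ?_
  rw [decRearr_comp _ _ φ.ext_superlevel]

theorem orliczModular_mono {f g : ℝ → ℝ} (h : ∀ᵐ x ∂orliczMeasure γ, |f x| ≤ |g x|) :
    orliczModular φ w f ≤ orliczModular φ w g := by
  refine lintegral_mono fun t => ?_
  dsimp only
  gcongr
  refine φ.ext_mono (decRearr_mono _ ?_ _)
  filter_upwards [h] with x hx
  exact enorm_le_iff_norm_le.2 hx

theorem orliczModular_convex {f g : ℝ → ℝ} (hf : AEMeasurable f (orliczMeasure γ))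
    (hg : AEMeasurable g (orliczMeasure γ)) {a b : ℝ≥0} (hab : a + b = 1) :
    orliczModular φ w (fun x => a * f x + b * g x) ≤
      a * orliczModular φ w f + b * orliczModular φ w g := by
  simp only [orliczModular_eq]
  have h1 : ∀ x, φ.ext ‖(a : ℝ) * f x + b * g x‖ₑ ≤ a * φ.ext ‖f x‖ₑ + b * φ.ext ‖g x‖ₑ := by
    intro x
    refine (φ.ext_mono ?_).trans (φ.ext_convex _ _ hab)
    refine (enorm_add_le _ _).trans ?_
    simp [enorm_mul]
  have hmf : AEMeasurable (fun x => φ.ext ‖f x‖ₑ) (orliczMeasure γ) :=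
    φ.ext_measurable.comp_aemeasurable hf.enorm
  have hmg : AEMeasurable (fun x => φ.ext ‖g x‖ₑ) (orliczMeasure γ) :=
    φ.ext_measurable.comp_aemeasurable hg.enorm
  refine (lintegral_mono fun t => mul_le_mul_left
    (decRearr_mono (orliczMeasure γ) (ae_of_all _ h1) (ENNReal.ofReal t)) _).trans ?_
  refine (lintegral_decRearr_weight_add_le w (hmf.const_mul _) (hmg.const_mul _)).trans ?_
  simp only [decRearr_const_mul, mul_assoc]
  rw [lintegral_const_mul' _ _ ENNReal.coe_ne_top, lintegral_const_mul' _ _ ENNReal.coe_ne_top]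

theorem orliczModular_zero : orliczModular φ w (fun _ => 0) = 0 := by
  have h : ∀ t, decRearr (orliczMeasure γ) (fun _ => (0 : ℝ≥0∞)) t = 0 := fun t => by
    refine le_antisymm (le_of_forall_lt fun s hs => ?_) (by simp)
    rw [lt_decRearr_iff] at hs
    simp at hs
  simp [orliczModular, h, φ.ext_zero]

end Modular

/-! ### The Orlicz-Lorentz space -/

section Space

variable {γ : ℝ≥0∞} (φ : OrliczFunction) (w : WeightFunction γ)

theorem orliczModular_smul_le (f : ℝ → ℝ) {c d : ℝ} (h : |c| ≤ |d|) :
    orliczModular φ w (fun x => c * f x) ≤ orliczModular φ w (fun x => d * f x) :=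
  orliczModular_mono φ w (ae_of_all _ fun x => by
    rw [abs_mul, abs_mul]; exact mul_le_mul_of_nonneg_right h (abs_nonneg _))

theorem orliczModular_smul_le_mul {f : ℝ → ℝ} (hf : AEMeasurable f (orliczMeasure γ))
    {a : ℝ≥0} (h : a ≤ 1) :
    orliczModular φ w (fun x => a * f x) ≤ a * orliczModular φ w f := by
  have := orliczModular_convex φ w hf (g := fun _ => 0) aemeasurable_const
    (add_tsub_cancel_of_le h)
  simpa [orliczModular_zero] using this

theorem orliczModular_congr {f g : ℝ → ℝ} (h : f =ᵐ[orliczMeasure γ] g) :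
    orliczModular φ w f = orliczModular φ w g :=
  le_antisymm (orliczModular_mono φ w (h.mono fun x hx => by rw [hx]))
    (orliczModular_mono φ w (h.mono fun x hx => by rw [hx]))

/-- `{f ∈ L_0 : ρ(k f) < ∞ for some k > 0}` as a linear space of classes of almost everywhere equal
measurable functions on `I`. A function with `ρ(k f) < ∞` is finite almost everywhere, so real
values suffice. -/
noncomputable def orliczLorentzSubmodule : Submodule ℝ (ℝ →ₘ[orliczMeasure γ] ℝ) where
  carrier := {f | ∃ k : ℝ, 0 < k ∧ orliczModular φ w (fun x => k * f x) < ∞}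
  zero_mem' := by
    refine ⟨1, one_pos, ?_⟩
    rw [orliczModular_congr φ w (g := fun _ => 0), orliczModular_zero]
    · simp
    · filter_upwards [AEEqFun.coeFn_zero (α := ℝ) (β := ℝ) (μ := orliczMeasure γ)] with x hx
      simp [hx]
  add_mem' := by
    rintro f g ⟨k, hk, hkf⟩ ⟨l, hl, hlg⟩
    have hm : 0 < min k l := lt_min hk hl
    refine ⟨min k l / 2, by positivity, ?_⟩
    have h1 := orliczModular_convex φ w (f := fun x => min k l * f x)
      (g := fun x => min k l * g x) (f.aestronglyMeasurable.aemeasurable.const_mul _)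
      (g.aestronglyMeasurable.aemeasurable.const_mul _) (add_halves (1 : ℝ≥0))
    have hf := (orliczModular_smul_le φ w f (c := min k l) (d := k) (by
      rw [abs_of_pos hm, abs_of_pos hk]; exact min_le_left _ _)).trans_lt hkf
    have hg := (orliczModular_smul_le φ w g (c := min k l) (d := l) (by
      rw [abs_of_pos hm, abs_of_pos hl]; exact min_le_right _ _)).trans_lt hlg
    refine lt_of_eq_of_lt (orliczModular_congr φ w ?_) (h1.trans_lt
      (ENNReal.add_lt_top.2 ⟨ENNReal.mul_lt_top ENNReal.coe_lt_top hf,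
        ENNReal.mul_lt_top ENNReal.coe_lt_top hg⟩))
    filter_upwards [AEEqFun.coeFn_add f g] with x hx
    simp only [hx, Pi.add_apply]
    push_cast
    ring
  smul_mem' := by
    rintro c f ⟨k, hk, hkf⟩
    refine ⟨k / (|c| + 1), by positivity, ?_⟩
    refine lt_of_eq_of_lt (orliczModular_congr φ w (g := fun x => (k / (|c| + 1) * c) * f x) ?_)
      ((orliczModular_smul_le φ w f ?_).trans_lt hkf)
    · filter_upwards [AEEqFun.coeFn_smul c f] with x hx
      simp only [hx, Pi.smul_apply, smul_eq_mul]
      ring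
    · rw [abs_mul, abs_div, abs_of_pos hk, abs_of_pos (by positivity : (0 : ℝ) < |c| + 1),
        div_mul_eq_mul_div, div_le_iff₀ (by positivity)]
      nlinarith [abs_nonneg c]

/-- The Orlicz-Lorentz function space on `I = [0, γ)`. -/
def OrliczLorentz : Type := ↥(orliczLorentzSubmodule φ w)

noncomputable instance : AddCommGroup (OrliczLorentz φ w) :=
  inferInstanceAs (AddCommGroup ↥(orliczLorentzSubmodule φ w))

noncomputable instance : Module ℝ (OrliczLorentz φ w) :=
  inferInstanceAs (Module ℝ ↥(orliczLorentzSubmodule φ w))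

/-- The Luxemburg norm `‖f‖ = inf {ε > 0 : ρ(f / ε) ≤ 1}`. -/
noncomputable instance : Norm (OrliczLorentz φ w) where
  norm f := sInf {ε : ℝ | 0 < ε ∧ orliczModular φ w (fun x => f.1 x / ε) ≤ 1}

end Space

section NormedSpace

variable {γ : ℝ≥0∞} (φ : OrliczFunction) (w : WeightFunction γ)

theorem orliczModular_coe_smul (c : ℝ) (f : OrliczLorentz φ w) :
    orliczModular φ w ((c • f).1) = orliczModular φ w (fun x => c * f.1 x) := by
  refine orliczModular_congr φ w ?_
  filter_upwards [AEEqFun.coeFn_smul c f.1] with x hx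
  exact hx

theorem OrliczLorentz.norm_eq_gauge (f : OrliczLorentz φ w) :
    ‖f‖ = gauge {g : OrliczLorentz φ w | orliczModular φ w g.1 ≤ 1} f := by
  rw [gauge_def']
  refine congrArg sInf (ext fun ε => ?_)
  simp only [mem_ofPred_eq, mem_Ioi, orliczModular_coe_smul, div_eq_inv_mul]

theorem OrliczLorentz.convex_unitBall :
    Convex ℝ {g : OrliczLorentz φ w | orliczModular φ w g.1 ≤ 1} := by
  intro f hf g hg a b ha hb hab
  lift a to ℝ≥0 using ha
  lift b to ℝ≥0 using hb
  have hab' : a + b = 1 := by exact_mod_cast hab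
  have h := orliczModular_convex φ w (f.1.aestronglyMeasurable.aemeasurable)
    (g.1.aestronglyMeasurable.aemeasurable) hab'
  refine le_trans (le_of_eq (orliczModular_congr φ w ?_)) (h.trans ?_)
  · have h1 : (((a : ℝ) • f + (b : ℝ) • g : OrliczLorentz φ w)).1 =
        (a : ℝ) • f.1 + (b : ℝ) • g.1 := rfl
    rw [h1]
    filter_upwards [AEEqFun.coeFn_add ((a : ℝ) • f.1) ((b : ℝ) • g.1),
      AEEqFun.coeFn_smul (a : ℝ) f.1, AEEqFun.coeFn_smul (b : ℝ) g.1] with x h2 h3 h4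
    simp [h2, h3, h4]
  · calc (a : ℝ≥0∞) * orliczModular φ w f.1 + b * orliczModular φ w g.1
        ≤ a * 1 + b * 1 := add_le_add (mul_le_mul_right hf _) (mul_le_mul_right hg _)
      _ = 1 := by rw [mul_one, mul_one]; exact_mod_cast hab'

theorem OrliczLorentz.balanced_unitBall :
    Balanced ℝ {g : OrliczLorentz φ w | orliczModular φ w g.1 ≤ 1} := by
  rw [balanced_iff_smul_mem]
  intro c hc f hf
  have h := orliczModular_smul_le φ w f.1 (c := c) (d := 1) (by simpa using hc)
  simp only [one_mul] at h
  exact (orliczModular_coe_smul φ w c f).le.trans (h.trans hf)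

theorem OrliczLorentz.absorbent_unitBall :
    Absorbent ℝ {g : OrliczLorentz φ w | orliczModular φ w g.1 ≤ 1} := by
  rw [absorbent_iff_inv_smul]
  intro f
  obtain ⟨k, hk, hkf⟩ := f.2
  obtain ⟨a, ha0, ha1, ha⟩ : ∃ a : ℝ≥0, 0 < a ∧ a ≤ 1 ∧
      a * orliczModular φ w (fun x => k * f.1 x) ≤ 1 := by
    set R := orliczModular φ w (fun x => k * f.1 x)
    lift R to ℝ≥0 using hkf.ne with r
    refine ⟨(1 + r)⁻¹, by positivity, inv_le_one_of_one_le₀ (by simp), ?_⟩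
    have h : (1 + r)⁻¹ * r ≤ 1 := by
      rw [inv_mul_le_iff₀ (by positivity), mul_one]
      simp
    exact_mod_cast h
  have hmem : orliczModular φ w (fun x => (a * k) * f.1 x) ≤ 1 := by
    refine le_trans (le_of_eq ?_) ((orliczModular_smul_le_mul φ w
      (f.1.aestronglyMeasurable.aemeasurable.const_mul k) ha1).trans ha)
    simp only [mul_assoc]
  have hak : 0 < (a : ℝ) * k := mul_pos (by exact_mod_cast ha0) hk
  filter_upwards [tendsto_norm_cobounded_atTop.eventually_ge_atTop ((a * k : ℝ)⁻¹)] with c hc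
  refine (orliczModular_coe_smul φ w c⁻¹ f).le.trans
    ((orliczModular_smul_le φ w f.1 ?_).trans hmem)
  rw [abs_inv, abs_of_pos hak]
  exact inv_le_of_inv_le₀ hak hc

theorem OrliczLorentz.eq_zero_of_norm (f : OrliczLorentz φ w) (hf : ‖f‖ = 0) : f = 0 := by
  have hall : ∀ ε : ℝ, 0 < ε → orliczModular φ w (fun x => ε⁻¹ * f.1 x) ≤ 1 := by
    intro ε hε
    rw [OrliczLorentz.norm_eq_gauge] at hf
    obtain ⟨b, hb0, hbε, hb⟩ := exists_lt_of_gauge_lt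
      (OrliczLorentz.absorbent_unitBall φ w) (hf.trans_lt hε)
    obtain ⟨g, hg, rfl⟩ := hb
    have h1 := orliczModular_smul_le φ w ((b • g).1) (c := ε⁻¹) (d := b⁻¹) (by
      rw [abs_of_pos (inv_pos.2 hε), abs_of_pos (inv_pos.2 hb0)]
      exact inv_anti₀ hb0 hbε.le)
    refine h1.trans ?_
    rw [← orliczModular_coe_smul, inv_smul_smul₀ hb0.ne']
    exact hg
  have hz : orliczMeasure γ {x | 0 < ‖f.1 x‖ₑ} = 0 := by
    by_contra hne
    obtain ⟨t', ht'0, ht'⟩ := exists_between (pos_iff_ne_zero.2 hne)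
    lift t' to ℝ≥0 using ht'.ne_top
    set t : ℝ := NNReal.toReal t'
    have htt : ENNReal.ofReal t = t' := ENNReal.ofReal_coe_nnreal
    have ht0 : 0 < t := by exact_mod_cast ht'0
    have hγ : ENNReal.ofReal t < γ := by
      by_contra hc
      push Not at hc
      refine absurd (ht'.trans_le (measure_mono (subset_univ _))) (not_lt.2 ?_)
      rw [orliczMeasure, Measure.restrict_apply_univ]
      have : orliczInterval γ ⊆ Ico 0 t := fun s hs =>
        ⟨hs.1, (ENNReal.ofReal_lt_ofReal_iff ht0).1 (hs.2.trans_le hc)⟩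
      refine (measure_mono this).trans ?_
      rw [Real.volume_Ico, sub_zero, htt]
    have hm := (lt_decRearr_iff (orliczMeasure γ) (fun x => ‖f.1 x‖ₑ) (ENNReal.ofReal t) 0).2
      (by rw [htt]; exact ht')
    obtain ⟨m, hm0, hm⟩ := exists_between hm
    lift m to ℝ≥0 using hm.ne_top
    have hm0' : 0 < m := by exact_mod_cast hm0
    have hsub : Ioc 0 t ⊆ orliczInterval γ := fun s hs =>
      ⟨hs.1.le, (ENNReal.ofReal_le_ofReal hs.2).trans_lt hγ⟩
    have hC : ∫⁻ s in Ioc 0 t, ENNReal.ofReal (w.toFun s) ≠ 0 := by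
      intro h0
      have hw : AEMeasurable w.toFun (volume.restrict (Ioc 0 t)) :=
        aemeasurable_restrict_of_antitoneOn measurableSet_Ioc
          (w.antitoneOn.mono fun s hs => ⟨hsub hs, hs.1⟩)
      rw [lintegral_eq_zero_iff' hw.ennreal_ofReal] at h0
      have h1 : ∀ᵐ s ∂volume.restrict (Ioc 0 t), False := by
        filter_upwards [h0, ae_restrict_mem measurableSet_Ioc] with s hs hst
        have := w.pos s (hsub hst) hst.1
        simp only [Pi.zero_apply, ENNReal.ofReal_eq_zero] at hs
        exact absurd this (not_lt.2 hs)
      have h2 : volume.restrict (Ioc 0 t) = 0 := ae_eq_bot.1 (eventually_false_iff_eq_bot.1 h1)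
      rw [Measure.restrict_eq_zero, Real.volume_Ioc, sub_zero, ENNReal.ofReal_eq_zero] at h2
      exact absurd ht0 (not_lt.2 h2)
    obtain ⟨n, hn⟩ := ENNReal.exists_nat_mul_gt hC ENNReal.one_ne_top
    obtain ⟨v, hv⟩ := φ.exists_forall_lt n
    have hv1 : 0 < max v 1 := lt_max_of_lt_right one_pos
    set e : ℝ≥0 := m / max v 1 with he
    have he0 : 0 < e := div_pos hm0' hv1
    refine absurd (hall e (by exact_mod_cast he0)) (not_le.2 (hn.trans_le ?_))
    rw [← lintegral_const_mul' _ _ (ENNReal.natCast_ne_top n)]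
    refine le_trans ?_ (lintegral_mono_set hsub)
    refine setLIntegral_mono' measurableSet_Ioc fun s hs => mul_le_mul_left ?_ _
    have h1 : (fun x => ‖((e : ℝ)⁻¹) * f.1 x‖ₑ) = fun x => ((e⁻¹ : ℝ≥0) : ℝ≥0∞) * ‖f.1 x‖ₑ := by
      funext x
      rw [enorm_mul]
      congr 1
      rw [← NNReal.coe_inv, Real.enorm_eq_ofReal (NNReal.coe_nonneg _), ENNReal.ofReal_coe_nnreal]
    have h2 : ((max v 1 : ℝ≥0) : ℝ≥0∞) ≤
        decRearr (orliczMeasure γ) (fun x => ‖((e : ℝ)⁻¹) * f.1 x‖ₑ) (ENNReal.ofReal s) := by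
      rw [h1, decRearr_const_mul]
      have h3 : max v 1 = e⁻¹ * m := by
        rw [he, inv_div, div_mul_cancel₀ _ hm0'.ne']
      rw [h3, ENNReal.coe_mul]
      exact mul_le_mul_right (hm.le.trans
        (decRearr_antitone _ _ (ENNReal.ofReal_le_ofReal hs.2))) _
    refine le_trans ?_ (φ.ext_mono h2)
    rw [φ.ext_coe]
    exact_mod_cast (hv _ (le_max_left v 1)).le
  refine Subtype.ext (AEEqFun.ext ?_)
  have h0 : ∀ᵐ x ∂orliczMeasure γ, ¬ 0 < ‖f.1 x‖ₑ := by
    rw [ae_iff]; simpa only [not_not] using hz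
  have hzero : (0 : OrliczLorentz φ w).1 = 0 := rfl
  rw [hzero]
  filter_upwards [h0, AEEqFun.coeFn_zero (α := ℝ) (β := ℝ) (μ := orliczMeasure γ)] with x hx h1
  rw [h1]
  simpa using hx

theorem OrliczLorentz.normedSpaceCore : NormedSpace.Core ℝ (OrliczLorentz φ w) where
  norm_nonneg f := by rw [OrliczLorentz.norm_eq_gauge]; exact gauge_nonneg f
  norm_smul c f := by
    rw [OrliczLorentz.norm_eq_gauge, OrliczLorentz.norm_eq_gauge]
    exact gauge_smul (OrliczLorentz.balanced_unitBall φ w) c f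
  norm_triangle f g := by
    rw [OrliczLorentz.norm_eq_gauge, OrliczLorentz.norm_eq_gauge, OrliczLorentz.norm_eq_gauge]
    exact gauge_add_le (OrliczLorentz.convex_unitBall φ w)
      (OrliczLorentz.absorbent_unitBall φ w) f g
  norm_eq_zero_iff f := by
    refine ⟨OrliczLorentz.eq_zero_of_norm φ w f, ?_⟩
    rintro rfl
    rw [OrliczLorentz.norm_eq_gauge, gauge_zero]

noncomputable instance : NormedAddCommGroup (OrliczLorentz φ w) :=
  NormedAddCommGroup.ofCore (OrliczLorentz.normedSpaceCore φ w)

noncomputable instance : NormedSpace ℝ (OrliczLorentz φ w) :=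
  NormedSpace.ofCore (OrliczLorentz.normedSpaceCore φ w)

end NormedSpace

/-! ### Diametral diameter two properties and the Daugavet property -/

section Properties

variable (X : Type*) [NormedAddCommGroup X] [NormedSpace ℝ X]

/-- The diametral local diameter two property: for every slice `S = {x ∈ B_X : x^* x > 1 - α}` of
the unit ball (`‖x^*‖ = 1`, `α > 0`), every `x ∈ S` with `‖x‖ = 1` and every `ε > 0` there is
`y ∈ S` with `‖x - y‖ ≥ 2 - ε`. -/
def HasDLD2P : Prop :=
  ∀ f : StrongDual ℝ X, ‖f‖ = 1 → ∀ α : ℝ, 0 < α →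
    ∀ x : X, ‖x‖ = 1 → 1 - α < f x → ∀ ε : ℝ, 0 < ε →
      ∃ y : X, ‖y‖ ≤ 1 ∧ 1 - α < f y ∧ 2 - ε ≤ ‖x - y‖

/-- The diametral diameter two property: the same with relatively weakly open subsets
`{x ∈ B_X : x ∈ U}`, `U` weakly open, in place of slices. -/
def HasDD2P : Prop :=
  ∀ U : Set (WeakSpace ℝ X), IsOpen U →
    ∀ x : X, ‖x‖ = 1 → toWeakSpace ℝ X x ∈ U → ∀ ε : ℝ, 0 < ε →
      ∃ y : X, ‖y‖ ≤ 1 ∧ toWeakSpace ℝ X y ∈ U ∧ 2 - ε ≤ ‖x - y‖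

/-- The Daugavet property: `‖I + T‖ = 1 + ‖T‖` for every bounded operator `T` of rank one. -/
def HasDaugavetProperty : Prop :=
  ∀ T : X →L[ℝ] X, Module.finrank ℝ T.range = 1 →
    ‖ContinuousLinearMap.id ℝ X + T‖ = 1 + ‖T‖

end Properties

/-! ### Diametral properties and uniformly non-square points -/

section Diametral

variable {X : Type*} [NormedAddCommGroup X] [NormedSpace ℝ X]

/-! Both the DD2P and the Daugavet property imply the DLD2P, so it is enough to refute the DLD2P
when `φ` is not linear. A single point `x` of the sphere does this, provided that for some `δ > 0`
every `y` in the ball satisfies `‖x + y‖ ≤ 2 - δ` or `‖x - y‖ ≤ 2 - δ`. In a thin slice around `x`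
cut out by a supporting functional, `x + y` has norm near `2`, hence `x - y` does not
(`not_hasDLD2P_of_norm_add_le_or_norm_sub_le`).

To find `x`, note that a nonlinear `φ` satisfies `φ(d/2) < φ(d)/2` for all large `d`
(`exists_forall_half_lt`). Choose `t` small and `d` large with `φ(d) ∫_0^t w = 1`, and let `x` be
`d` times the indicator of `(0, t)`. Given `y` with `ρ(y) ≤ 1`, one of `y`, `-y` is nonnegative on a
set `E ⊆ (0, t)` of measure at least `t/2`; say `y` is. For `a + b = 1` with `b` slightly above
`1/2`, convexity gives the pointwise bound `φ(b|x - y|) ≤ G`, where `G = a φ((b/a)x) + b φ(|y|)`. On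
`E` there is no addition of absolute values, since `|d - y| ≤ max(d, y)`, and the bound improves by
a fixed `η > 0` (`map_abs_sub_add_le`).

The Lorentz functional `G ↦ ∫ G^* w` is strictly monotone in a uniform way: lowering `G` by `η` on a
set of measure at least `t/2` lowers it by some `l > 0` independent of `y`, `b` and `G`
(`exists_lorentzFunctional_add_le`). It is subadditive, so its value at `G` is at most `1 + l` once
`b` is close to `1/2`. Hence `ρ(b(x - y)) ≤ 1`, that is, `‖x - y‖ ≤ 1/b < 2`
(`exists_orliczModular_sub_le_one`). -/

theorem HasDD2P.hasDLD2P (h : HasDD2P X) : HasDLD2P X := by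
  intro f _ α _ x hx hfx ε hε
  have hU : IsOpen {z : WeakSpace ℝ X | 1 - α < f ((toWeakSpace ℝ X).symm z)} :=
    isOpen_lt continuous_const (WeakBilin.eval_continuous (topDualPairing ℝ X).flip f)
  obtain ⟨y, hy, hyU, hxy⟩ := h _ hU x hx (by simpa using hfx) ε hε
  exact ⟨y, hy, by simpa using hyU, hxy⟩

/-- The Daugavet equation is applied to `T z = -f(z) x`, which has norm one. Some `y` in the open
ball then almost attains `‖y - f(y) x‖ = 2`, and up to sign this `y` lies in the slice and is almost
at distance `2` from `x`. -/
theorem HasDaugavetProperty.hasDLD2P (h : HasDaugavetProperty X) : HasDLD2P X := by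
  intro f hf α hα x hx _ ε hε
  have hx0 : x ≠ 0 := by
    rintro rfl
    simp at hx
  have hf0 : f ≠ 0 := by
    rintro rfl
    simp at hf
  set T : X →L[ℝ] X := f.smulRight (-x) with hT
  have hTn : ‖T‖ = 1 := by
    rw [hT, ContinuousLinearMap.norm_smulRight_apply, hf, norm_neg, hx, one_mul]
  have hrange : T.range = Submodule.span ℝ {-x} := by
    obtain ⟨v, hv⟩ := DFunLike.ne_iff.1 hf0
    have hv' : f v ≠ 0 := hv
    ext z
    rw [Submodule.mem_span_singleton]
    constructor
    · rintro ⟨u, rfl⟩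
      exact ⟨f u, rfl⟩
    · rintro ⟨c, rfl⟩
      refine ⟨(c / f v) • v, ?_⟩
      change f ((c / f v) • v) • (-x) = c • (-x)
      rw [map_smul, smul_eq_mul, div_mul_cancel₀ _ hv']
  have hT1 : Module.finrank ℝ T.range = 1 := by
    rw [hrange]
    exact finrank_span_singleton (neg_ne_zero.2 hx0)
  have hnorm := h T hT1
  rw [hTn] at hnorm
  set r : ℝ := min (min α (ε / 2)) 1 with hr
  have hr0 : 0 < r := lt_min (lt_min hα (half_pos hε)) one_pos
  have hrα : r ≤ α := (min_le_left _ _).trans (min_le_left _ _)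
  have hrε : r ≤ ε / 2 := (min_le_left _ _).trans (min_le_right _ _)
  have hr1 : r ≤ 1 := min_le_right _ _
  obtain ⟨y, hy1, hy⟩ := (ContinuousLinearMap.id ℝ X + T).exists_lt_apply_of_lt_opNorm
    (r := 2 - r) (by rw [hnorm]; linarith)
  -- The bound `‖z‖ + f z > 2 - r` forces `f z > 1 - r`. Then `z - f(z) x = (1 - f z) x - (x - z)`
  -- differs from `-(x - z)` by less than `r`, so `‖x - z‖ > 2 - 2r ≥ 2 - ε`.
  have key : ∀ z : X, ‖z‖ < 1 → 0 ≤ f z → 2 - r < ‖z + f z • (-x)‖ →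
      1 - α < f z ∧ 2 - ε ≤ ‖x - z‖ := by
    intro z hz hfz hzn
    have h1 : ‖f z • (-x)‖ = f z := by
      rw [norm_smul, norm_neg, hx, mul_one, Real.norm_of_nonneg hfz]
    have h2 := norm_add_le z (f z • (-x))
    have hfz1 : f z ≤ 1 := by
      have := f.le_opNorm z
      rw [hf, one_mul] at this
      exact (Real.le_norm_self _).trans (this.trans hz.le)
    have h3 : z + f z • (-x) = (1 - f z) • x - (x - z) := by
      rw [sub_smul, one_smul, smul_neg]; abel
    have h4 : ‖(1 - f z) • x‖ = 1 - f z := by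
      rw [norm_smul, hx, mul_one, Real.norm_of_nonneg (by linarith)]
    have h5 := norm_sub_le ((1 - f z) • x) (x - z)
    rw [← h3, h4] at h5
    rw [h1] at h2
    constructor <;> linarith
  have hy' : 2 - r < ‖y + f y • (-x)‖ := hy
  rcases le_total 0 (f y) with h0 | h0
  · exact ⟨y, hy1.le, key y hy1 h0 hy'⟩
  · refine ⟨-y, by rw [norm_neg]; exact hy1.le, key (-y) (by rwa [norm_neg])
      (by rw [map_neg]; linarith) ?_⟩
    rw [map_neg, neg_smul, ← neg_add, norm_neg]
    exact hy'

/-- A space with a uniformly non-`ℓ₁²` point fails the diametral local diameter two property. -/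
theorem not_hasDLD2P_of_norm_add_le_or_norm_sub_le {x : X} (hx : ‖x‖ = 1) {δ : ℝ} (hδ : 0 < δ)
    (h : ∀ y : X, ‖y‖ ≤ 1 → ‖x + y‖ ≤ 2 - δ ∨ ‖x - y‖ ≤ 2 - δ) : ¬ HasDLD2P X := by
  intro hX
  -- The slice is cut out by a supporting functional of `x` with `α = δ`. In it `f (x + y) > 2 - δ`,
  -- which excludes the first alternative; the second contradicts `‖x - y‖ ≥ 2 - δ/2`.
  obtain ⟨f, hf, hfx⟩ := exists_dual_vector ℝ x (by rw [hx]; exact one_ne_zero)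
  rw [hx] at hfx
  have hfx' : f x = 1 := by simpa using hfx
  obtain ⟨y, hy, hfy, hxy⟩ := hX f hf δ hδ x hx (by rw [hfx']; linarith) (δ / 2) (half_pos hδ)
  rcases h y hy with h1 | h1
  · have h2 := f.le_opNorm (x + y)
    rw [hf, one_mul, map_add, hfx'] at h2
    have := Real.le_norm_self (1 + f y)
    linarith
  · linarith

end Diametral

/-! ### Nonlinear Orlicz functions -/

namespace OrliczFunction

/-- Convexity puts the graph below the chord from `0` to `d`. If it dipped strictly below at some `u
≤ d/2`, then, `d/2` lying between `u` and `d`, it would be strictly below at `d/2` as well. -/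
theorem eq_mul_of_half_eq (φ : OrliczFunction) {d u : ℝ≥0} (hd : φ.toFun d / 2 ≤ φ.toFun (d / 2))
    (hu : u < d) (hu2 : u ≤ d / 2) : φ.toFun u = φ.toFun d / d * u := by
  have hd0 : 0 < d := lt_of_le_of_lt (zero_le (a := u)) hu
  refine le_antisymm ?_ ?_
  · have h := φ.map_mul_le (c := u / d) (div_le_one_of_le₀ hu.le hd0.le) d
    rw [div_mul_cancel₀ _ hd0.ne'] at h
    calc φ.toFun u ≤ u / d * φ.toFun d := h
      _ = _ := by ring
  · have hdu : (0 : ℝ) < d - u := sub_pos.2 (by exact_mod_cast hu)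
    have hdR : (0 : ℝ) < d := by exact_mod_cast hd0
    have huR : (u : ℝ) ≤ d / 2 := by exact_mod_cast hu2
    -- The barycentric coordinates of `d/2` in the interval `[u, d]`.
    obtain ⟨a, ha⟩ : ∃ a : ℝ≥0, (a : ℝ) = (d / 2) / (d - u) := ⟨⟨_, by positivity⟩, rfl⟩
    obtain ⟨b, hb⟩ : ∃ b : ℝ≥0, (b : ℝ) = (d / 2 - u) / (d - u) :=
      ⟨⟨_, div_nonneg (by linarith) hdu.le⟩, rfl⟩
    have hab : a + b = 1 := by
      rw [← NNReal.coe_inj]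
      push_cast
      rw [ha, hb, ← add_div, div_eq_one_iff_eq hdu.ne']
      ring
    have hcomb : a * u + b * d = d / 2 := by
      rw [← NNReal.coe_inj]
      push_cast
      rw [ha, hb]
      field_simp
      ring
    have h := φ.convexOn.2 (mem_univ u) (mem_univ d) (zero_le (a := a)) (zero_le (a := b)) hab
    simp only [smul_eq_mul, hcomb] at h
    have h' : (φ.toFun d : ℝ) / 2 ≤ a * φ.toFun u + b * φ.toFun d := by
      exact_mod_cast hd.trans h
    rw [ha, hb] at h'
    rw [← NNReal.coe_le_coe]
    push_cast
    rw [div_mul_eq_mul_div, div_le_iff₀ hdR]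
    have h2 := mul_le_mul_of_nonneg_right h' hdu.le
    have h3 : ((d : ℝ) / 2 / (d - u) * φ.toFun u + (d / 2 - u) / (d - u) * φ.toFun d) * (d - u)
        = d / 2 * φ.toFun u + (d / 2 - u) * φ.toFun d := by
      field_simp
    rw [h3] at h2
    nlinarith

theorem exists_forall_half_lt (φ : OrliczFunction)
    (h : ¬ ∃ k : ℝ≥0, 0 < k ∧ ∀ u : ℝ≥0, φ.toFun u = k * u) :
    ∃ D : ℝ≥0, ∀ d, D ≤ d → φ.toFun (d / 2) < φ.toFun d / 2 := by
  by_contra! hc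
  refine h ?_
  have hlin : ∀ v : ℝ≥0, ∃ k : ℝ≥0, ∀ u ≤ v, φ.toFun u = k * u := by
    intro v
    -- The extra `1` keeps `u < d` strict even for `v = 0`.
    obtain ⟨d, hd, hd2⟩ := hc (2 * v + 1)
    have hvd : 2 * v < d := lt_of_lt_of_le (lt_add_of_pos_right _ one_pos) hd
    refine ⟨φ.toFun d / d, fun u hu => φ.eq_mul_of_half_eq hd2 ?_ ?_⟩
    · refine lt_of_le_of_lt (hu.trans ?_) hvd
      rw [two_mul]; exact le_add_of_nonneg_left (zero_le (a := v))
    · rw [le_div_iff₀ two_pos, mul_comm]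
      exact (mul_le_mul_right hu 2).trans hvd.le
  -- The slopes on different initial segments agree because each equals `φ(1)`.
  obtain ⟨k, hk⟩ := hlin 1
  have hall : ∀ u, φ.toFun u = k * u := by
    intro u
    obtain ⟨l, hl⟩ := hlin (max u 1)
    have h1 := hk 1 le_rfl
    have h2 := hl 1 (le_max_right _ _)
    rw [mul_one] at h1 h2
    rw [hl u (le_max_left _ _), ← h1, h2]
  obtain ⟨u, hu⟩ := φ.ne_zero
  refine ⟨k, pos_iff_ne_zero.2 ?_, hall⟩
  rintro rfl
  exact hu (by rw [hall u, zero_mul])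

end OrliczFunction

/-! ### Strict monotonicity of the Lorentz functional -/

theorem decRearr_tsub_const {α : Type*} [MeasurableSpace α] (μ : Measure α) (g : α → ℝ≥0∞)
    (c t : ℝ≥0∞) : decRearr μ (fun x => g x - c) t = decRearr μ g t - c :=
  decRearr_comp μ g (ψ := fun u => u - c) (fun s _ => ⟨c + s, fun _ => lt_tsub_iff_left⟩) t

theorem decRearr_eq_zero_of_measure_univ_le {α : Type*} [MeasurableSpace α] (μ : Measure α)
    (g : α → ℝ≥0∞) {t : ℝ≥0∞} (ht : μ univ ≤ t) : decRearr μ g t = 0 := by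
  by_contra h
  have := (lt_decRearr_iff μ g t 0).1 (pos_iff_ne_zero.2 h)
  exact absurd (this.trans_le ((measure_mono (subset_univ _)).trans ht)) (lt_irrefl _)

theorem decRearr_indicator_const {α : Type*} [MeasurableSpace α] (μ : Measure α) (A : Set α)
    (c t : ℝ≥0∞) :
    decRearr μ (A.indicator fun _ => c) t = if t < μ A then c else 0 := by
  have hs : ∀ s, {x | s < A.indicator (fun _ => c) x} = if s < c then A else ∅ := by
    intro s
    split_ifs with h <;> ext x <;> by_cases hx : x ∈ A <;> simp [hx, h]
  refine eq_of_forall_lt_iff fun s => ?_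
  rw [lt_decRearr_iff, hs]
  by_cases h1 : s < c <;> by_cases h2 : t < μ A <;> simp [h1, h2]

section Weight

variable {γ : ℝ≥0∞} (w : WeightFunction γ)

/-- The Lorentz functional `G ↦ ∫_I G^* w`. -/
noncomputable def lorentzFunctional (G : ℝ → ℝ≥0∞) : ℝ≥0∞ :=
  ∫⁻ t in orliczInterval γ, decRearr (orliczMeasure γ) G (ENNReal.ofReal t) *
    ENNReal.ofReal (w.toFun t)

/-- The integral `∫_0^t w` of the weight. -/
noncomputable def weightIntegral (t : ℝ) : ℝ≥0∞ := ∫⁻ s in Ioo 0 t, ENNReal.ofReal (w.toFun s)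

theorem orliczModular_eq_lorentzFunctional (φ : OrliczFunction) (f : ℝ → ℝ) :
    orliczModular φ w f = lorentzFunctional w fun x => φ.ext ‖f x‖ₑ :=
  orliczModular_eq φ w f

theorem Ioo_subset_orliczInterval {t : ℝ} (ht : t ∈ orliczInterval γ) :
    Ioo 0 t ⊆ orliczInterval γ := fun _ hs =>
  ⟨hs.1.le, (ENNReal.ofReal_le_ofReal hs.2.le).trans_lt ht.2⟩

theorem aemeasurable_weight :
    AEMeasurable (fun t => ENNReal.ofReal (w.toFun t)) (volume.restrict (orliczInterval γ)) := by
  have hK : MeasurableSet (orliczInterval γ ∩ Ioi 0) :=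
    (measurableSet_orliczInterval γ).inter measurableSet_Ioi
  have hIK : (orliczInterval γ ∩ Ioi 0 : Set ℝ) =ᵐ[volume] orliczInterval γ := by
    refine (ae_eq_set_inter (ae_eq_refl _) Ioi_ae_eq_Ici).trans (ae_of_all _ fun t => ?_)
    exact propext ⟨fun h => h.1, fun h => ⟨h, h.1⟩⟩
  rw [← Measure.restrict_congr_set hIK]
  exact (aemeasurable_restrict_of_antitoneOn hK w.antitoneOn).ennreal_ofReal

theorem weightIntegral_ne_zero {t : ℝ} (ht : t ∈ orliczInterval γ) (ht0 : 0 < t) :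
    weightIntegral w t ≠ 0 := by
  intro h0
  rw [weightIntegral, lintegral_eq_zero_iff' ((aemeasurable_weight w).mono_measure
    (Measure.restrict_mono (Ioo_subset_orliczInterval ht) le_rfl))] at h0
  have h1 : ∀ᵐ s ∂volume.restrict (Ioo 0 t), False := by
    filter_upwards [h0, ae_restrict_mem measurableSet_Ioo] with s hs hst
    have := w.pos s (Ioo_subset_orliczInterval ht hst) hst.1
    simp only [Pi.zero_apply, ENNReal.ofReal_eq_zero] at hs
    exact absurd this (not_lt.2 hs)
  have h2 : volume.restrict (Ioo 0 t) = 0 := ae_eq_bot.1 (eventually_false_iff_eq_bot.1 h1)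
  rw [Measure.restrict_eq_zero, Real.volume_Ioo, sub_zero, ENNReal.ofReal_eq_zero] at h2
  exact absurd ht0 (not_lt.2 h2)

theorem weightIntegral_ne_top {t : ℝ} (ht : t ∈ orliczInterval γ) : weightIntegral w t ≠ ∞ :=
  ((w.integrableOn t ht).mono_set Ioo_subset_Ico_self).lintegral_lt_top.ne

/-- A Chebyshev inequality: `G^* ≥ G^*(t)` on `(0, t)`. -/
theorem decRearr_mul_weightIntegral_le (G : ℝ → ℝ≥0∞) {t : ℝ} (ht : t ∈ orliczInterval γ) :
    decRearr (orliczMeasure γ) G (ENNReal.ofReal t) * weightIntegral w t ≤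
      lorentzFunctional w G := by
  rw [weightIntegral, ← lintegral_const_mul'' _ ((aemeasurable_weight w).mono_measure
    (Measure.restrict_mono (Ioo_subset_orliczInterval ht) le_rfl))]
  refine le_trans ?_ (lintegral_mono_set (Ioo_subset_orliczInterval ht))
  exact setLIntegral_mono' measurableSet_Ioo fun s hs => mul_le_mul_left
    (decRearr_antitone _ _ (ENNReal.ofReal_le_ofReal hs.2.le)) _

/-- The companion estimate, with the weight bounded below by `w(t)` on `(0, t)`. It turns finiteness
of the Lorentz functional into integrability over `(0, t)`. -/
theorem lintegral_decRearr_mul_weight_le (G : ℝ → ℝ≥0∞) {t : ℝ} (ht : t ∈ orliczInterval γ)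
    (ht0 : 0 < t) {F : ℝ → ℝ≥0∞} (hF : Measurable F)
    (hFG : ∀ s ∈ Ioo 0 t, F s ≤ decRearr (orliczMeasure γ) G (ENNReal.ofReal s)) :
    (∫⁻ s in Ioo 0 t, F s) * ENNReal.ofReal (w.toFun t) ≤ lorentzFunctional w G := by
  rw [← lintegral_mul_const _ hF]
  refine le_trans ?_ (lintegral_mono_set (Ioo_subset_orliczInterval ht))
  exact setLIntegral_mono' measurableSet_Ioo fun s hs => mul_le_mul' (hFG s hs)
    (ENNReal.ofReal_le_ofReal
      (w.antitoneOn ⟨Ioo_subset_orliczInterval ht hs, hs.1⟩ ⟨ht, ht0⟩ hs.2.le))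

theorem orliczMeasure_univ_le : orliczMeasure γ univ ≤ γ := by
  rw [orliczMeasure, Measure.restrict_apply_univ]
  rcases eq_or_ne γ ∞ with rfl | hγ
  · exact le_top
  have : orliczInterval γ ⊆ Ico 0 γ.toReal := fun s hs =>
    ⟨hs.1, (ENNReal.ofReal_lt_iff_lt_toReal hs.1 hγ).1 hs.2⟩
  refine (measure_mono this).trans ?_
  rw [Real.volume_Ico, sub_zero, ENNReal.ofReal_toReal hγ]

theorem exists_lt_weightIntegral (w : WeightFunction ∞) {c : ℝ≥0∞} (hc : c < ∞) :
    ∃ M : ℝ, 0 < M ∧ c < weightIntegral w M := by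
  have hU : (⋃ n : ℕ, Ioo (0 : ℝ) (n + 1)) = Ioi 0 := by
    ext x
    simp only [mem_iUnion, mem_Ioo, mem_Ioi]
    refine ⟨fun ⟨n, h⟩ => h.1, fun hx => ?_⟩
    obtain ⟨n, hn⟩ := exists_nat_gt x
    exact ⟨n, hx, hn.trans (lt_add_one _)⟩
  have hmono : Monotone fun n : ℕ => Ioo (0 : ℝ) (n + 1) := fun m n hmn =>
    Ioo_subset_Ioo_right (by gcongr)
  have h1 := setLIntegral_iUnion_of_directed (μ := volume)
    (fun t => ENNReal.ofReal (w.toFun t)) hmono.directed_le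
  rw [hU, setLIntegral_congr Ioi_ae_eq_Ici, w.lintegral_eq_top rfl] at h1
  rw [h1] at hc
  obtain ⟨n, hn⟩ := lt_iSup_iff.1 hc
  exact ⟨n + 1, by positivity, hn⟩

/-- If lowering `G` to `H` loses a fixed amount of mass above the level `s`, not all of it beyond
the point `M`, then the Lorentz functional drops by a fixed amount. -/
theorem lorentzFunctional_add_le {G H : ℝ → ℝ≥0∞} (hG : AEMeasurable G (orliczMeasure γ))
    (hH : AEMeasurable H (orliczMeasure γ)) (hHG : H ≤ G) (hfin : lorentzFunctional w G ≠ ∞)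
    {M : ℝ} (hM : M ∈ orliczInterval γ) (hM0 : 0 < M) {s κ : ℝ≥0∞}
    (hmass : (∫⁻ x, (H x - s) ∂orliczMeasure γ) + (κ + κ) ≤ ∫⁻ x, (G x - s) ∂orliczMeasure γ)
    (hκ : κ ≠ ∞)
    (htop : ∫⁻ t in Ici M, (decRearr (orliczMeasure γ) H (ENNReal.ofReal t) - s) ≠ ∞)
    (htail : ∫⁻ t in Ici M, (decRearr (orliczMeasure γ) G (ENNReal.ofReal t) - s) ≤
      (∫⁻ t in Ici M, (decRearr (orliczMeasure γ) H (ENNReal.ofReal t) - s)) + κ) :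
    lorentzFunctional w H + κ * ENNReal.ofReal (w.toFun M) ≤ lorentzFunctional w G := by
  set g : ℝ → ℝ≥0∞ := fun t => decRearr (orliczMeasure γ) G (ENNReal.ofReal t) with hg
  set h : ℝ → ℝ≥0∞ := fun t => decRearr (orliczMeasure γ) H (ENNReal.ofReal t) with hh
  have hgm : Measurable g := measurable_decRearr _ _
  have hhm : Measurable h := measurable_decRearr _ _
  have hhg : ∀ t, h t ≤ g t := fun t => decRearr_mono _ (ae_of_all _ hHG) _
  have hwM : ENNReal.ofReal (w.toFun M) ≠ 0 := by
    simpa using w.pos M hM hM0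
  have hsplit : ∀ F : ℝ → ℝ≥0∞,
      ∫⁻ t in Ioi (0 : ℝ), F t = (∫⁻ t in Ioo 0 M, F t) + ∫⁻ t in Ici M, F t := by
    intro F
    rw [← lintegral_union measurableSet_Ici, Ioo_union_Ici_eq_Ioi hM0]
    exact disjoint_left.2 fun t ht ht' => absurd ht.2 (not_lt.2 ht')
  -- Integrals above the level `s` are the same for a function and its rearrangement, so the loss of
  -- mass can be located on the half line and split at `M`.
  rw [← lintegral_decRearr_tsub _ hG, ← lintegral_decRearr_tsub _ hH, hsplit, hsplit] at hmass
  -- Of the lost mass `2κ`, at most `κ` sits beyond `M`. The tail of `H` and one `κ` are cancelled,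
  -- which is legitimate because both are finite.
  have h1 : (∫⁻ t in Ioo 0 M, (h t - s)) + κ ≤ ∫⁻ t in Ioo 0 M, (g t - s) := by
    refine (ENNReal.add_le_add_iff_right (ENNReal.add_ne_top.2 ⟨htop, hκ⟩)).1
      (le_trans (le_trans (le_of_eq ?_) hmass) (add_le_add_right htail _))
    ring
  have hhtop : ∫⁻ t in Ioo 0 M, (h t - s) ≠ ∞ := by
    intro hT
    have := lintegral_decRearr_mul_weight_le w G hM hM0 (F := fun t => h t - s)
      (hhm.sub measurable_const) (fun t _ => tsub_le_self.trans (hhg t))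
    rw [hT, ENNReal.top_mul hwM, top_le_iff] at this
    exact hfin this
  have h2 : κ ≤ ∫⁻ t in Ioo 0 M, (g t - h t) := by
    refine (ENNReal.add_le_add_iff_left hhtop).1 (h1.trans ?_)
    rw [← lintegral_add_left (f := fun t => h t - s) (hhm.sub measurable_const)]
    refine lintegral_mono fun t => ?_
    rw [add_comm]
    exact tsub_le_tsub_add_tsub
  -- On `(0, M)` the weight is at least `w(M) > 0`.
  have hdiff : κ * ENNReal.ofReal (w.toFun M) ≤
      ∫⁻ t in orliczInterval γ, (g t - h t) * ENNReal.ofReal (w.toFun t) := by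
    refine (mul_le_mul_left h2 _).trans ?_
    rw [← lintegral_mul_const _ (f := fun t => g t - h t) (hgm.sub hhm)]
    refine le_trans ?_ (lintegral_mono_set (Ioo_subset_orliczInterval hM))
    exact setLIntegral_mono' measurableSet_Ioo fun t ht => mul_le_mul_right
      (ENNReal.ofReal_le_ofReal
        (w.antitoneOn ⟨Ioo_subset_orliczInterval hM ht, ht.1⟩ ⟨hM, hM0⟩ ht.2.le)) _
  refine (add_le_add_right hdiff _).trans ?_
  rw [lorentzFunctional, lorentzFunctional,
    ← lintegral_add_left' (f := fun t => h t * ENNReal.ofReal (w.toFun t))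
      (hhm.aemeasurable.mul (aemeasurable_weight w))]
  refine lintegral_mono fun t => ?_
  dsimp only
  rw [← add_mul, add_tsub_cancel_of_le (hhg t)]

/-- Lowering a function by a fixed amount on a set of fixed measure lowers the Lorentz functional
by an amount that depends on nothing else. -/
theorem exists_lorentzFunctional_add_le (hγ : 0 < γ) {η e : ℝ≥0} (hη : 0 < η) (he : 0 < e) :
    ∃ l : ℝ≥0, 0 < l ∧ ∀ G : ℝ → ℝ≥0∞, AEMeasurable G (orliczMeasure γ) →
      ∀ E : Set ℝ, MeasurableSet E → e ≤ orliczMeasure γ E → (∀ x ∈ E, η ≤ G x) →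
        lorentzFunctional w G ≤ 2 →
        lorentzFunctional w (fun x => G x - E.indicator (fun _ => (η : ℝ≥0∞)) x) + l ≤
          lorentzFunctional w G := by
  -- On `E` the function drops from at least `η = 2s` by `η`, so the part above the level `s` loses
  -- at least `s` there, in total `s e = 2κ`. Truncating at a positive level is what controls the
  -- tail when `γ = ∞`, where `∫ G` itself may be infinite.
  set s : ℝ≥0 := η / 2 with hs
  set κ : ℝ≥0 := s * e / 2 with hκ
  have hs0 : 0 < s := half_pos hη
  have hss : s + s = η := add_halves η
  -- It remains to choose `M`, from the bounds available for every admissible `G` at once, so that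
  -- at most `κ` of the loss happens beyond it.
  suffices hMex : ∃ M ∈ orliczInterval γ, 0 < M ∧ ∀ g h : ℝ → ℝ≥0∞, Antitone g → (∀ t, h t ≤ g t) →
      (∀ t, g t ≤ h t + η) → (∀ t, γ ≤ ENNReal.ofReal t → g t = 0) →
      g M * weightIntegral w M ≤ 2 →
      ∫⁻ t in Ici M, (h t - s) ≠ ∞ ∧
        ∫⁻ t in Ici M, (g t - s) ≤ (∫⁻ t in Ici M, (h t - s)) + κ by
    obtain ⟨M, hM, hM0, hMt⟩ := hMex
    refine ⟨κ * (w.toFun M).toNNReal, mul_pos (by positivity)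
      (Real.toNNReal_pos.2 (w.pos M hM hM0)), fun G hG E hE heE hGE hG2 => ?_⟩
    set H : ℝ → ℝ≥0∞ := fun x => G x - E.indicator (fun _ => (η : ℝ≥0∞)) x with hHdef
    have hH : AEMeasurable H (orliczMeasure γ) :=
      hG.sub (measurable_const.indicator hE).aemeasurable
    have hHG : H ≤ G := fun x => tsub_le_self
    have hGH : ∀ x, G x - η ≤ H x := fun x =>
      tsub_le_tsub_left (indicator_le_self E (fun _ => (η : ℝ≥0∞)) x) (G x)
    obtain ⟨h1, h2⟩ := hMt (fun t => decRearr (orliczMeasure γ) G (ENNReal.ofReal t))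
      (fun t => decRearr (orliczMeasure γ) H (ENNReal.ofReal t))
      (fun _ _ ht => decRearr_antitone _ _ (ENNReal.ofReal_le_ofReal ht))
      (fun t => decRearr_mono _ (ae_of_all _ hHG) _)
      (fun t => by
        have := decRearr_mono (orliczMeasure γ) (ae_of_all _ hGH) (ENNReal.ofReal t)
        rw [decRearr_tsub_const] at this
        exact tsub_le_iff_right.1 this)
      (fun t ht => decRearr_eq_zero_of_measure_univ_le _ _ (orliczMeasure_univ_le.trans ht))
      ((decRearr_mul_weightIntegral_le w G hM).trans hG2)
    have hmass : (∫⁻ x, (H x - s) ∂orliczMeasure γ) + ((κ : ℝ≥0∞) + κ) ≤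
        ∫⁻ x, (G x - s) ∂orliczMeasure γ := by
      calc (∫⁻ x, (H x - s) ∂orliczMeasure γ) + ((κ : ℝ≥0∞) + κ)
          ≤ (∫⁻ x, (H x - s) ∂orliczMeasure γ) + s * orliczMeasure γ E := by
            refine add_le_add_right ?_ _
            refine le_trans (le_of_eq ?_) (mul_le_mul_right heE _)
            rw [← ENNReal.coe_add, ← ENNReal.coe_mul, hκ, add_halves]
        _ = ∫⁻ x, ((H x - s) + E.indicator (fun _ => (s : ℝ≥0∞)) x) ∂orliczMeasure γ := by
            rw [lintegral_add_right _ (measurable_const.indicator hE), lintegral_indicator_const hE]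
        _ ≤ _ := by
            refine lintegral_mono fun x => ?_
            by_cases hx : x ∈ E
            · have hxG := hGE x hx
              simp only [hHdef, indicator_of_mem hx]
              rw [← hss, ENNReal.coe_add, ← tsub_tsub]
              rw [← hss, ENNReal.coe_add] at hxG
              have hsG : (s : ℝ≥0∞) ≤ G x - s :=
                ENNReal.le_sub_of_add_le_right ENNReal.coe_ne_top hxG
              exact (add_le_add_left tsub_le_self _).trans (tsub_add_cancel_of_le hsG).le
            · simp [hHdef, indicator_of_notMem hx]
    have := lorentzFunctional_add_le w hG hH hHG (ne_top_of_le_ne_top (by simp) hG2) hM hM0 hmass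
      ENNReal.coe_ne_top h1 h2
    rwa [ENNReal.coe_mul]
  rcases eq_or_ne γ ∞ with rfl | hγt
  -- For `γ = ∞` the divergence of `∫ w` gives `M` with `s ∫_0^M w > 2`. Then `G^*(M) ≤ s` by the
  -- Chebyshev bound, and nothing above the level `s` remains beyond `M`.
  · obtain ⟨M, hM0, hM⟩ := exists_lt_weightIntegral w (c := 2 / s)
      (ENNReal.div_lt_top (by simp) (by simpa using hs0.ne'))
    refine ⟨M, ⟨hM0.le, ENNReal.ofReal_lt_top⟩, hM0, fun g h hg hhg _ _ hgM => ?_⟩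
    have hgs : g M ≤ s := by
      by_contra! hc
      rw [ENNReal.div_lt_iff (Or.inl (by simpa using hs0.ne')) (Or.inl ENNReal.coe_ne_top)] at hM
      refine absurd hgM (not_le.2 (hM.trans_le ?_))
      rw [mul_comm]
      exact mul_le_mul_left hc.le _
    have hz : ∀ f : ℝ → ℝ≥0∞, (∀ t, f t ≤ g t) → ∫⁻ t in Ici M, (f t - s) = 0 := by
      intro f hf
      rw [setLIntegral_congr_fun (g := fun _ => 0) measurableSet_Ici fun t ht =>
        tsub_eq_zero_of_le ((hf t).trans ((hg ht).trans hgs)), lintegral_zero]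
    rw [hz h hhg, hz g fun _ => le_rfl]
    exact ⟨ENNReal.zero_ne_top, zero_le⟩
  · lift γ to ℝ≥0 using hγt
    have hγ0 : (0 : ℝ) < γ := by exact_mod_cast hγ
    -- For finite `γ` take `M = γ - θ`. As `G^* ≤ H^* + η`, the tail loses at most `ηθ ≤ ηe/4 = κ`;
    -- the bound `θ ≤ γ/2` keeps `M` positive.
    obtain ⟨θ, hθ0, hθe, hθγ⟩ : ∃ θ : ℝ, 0 < θ ∧ θ ≤ e / 4 ∧ θ < γ := by
      have he' : (0 : ℝ) < e := by exact_mod_cast he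
      exact ⟨min (e / 4) (γ / 2), lt_min (by positivity) (by positivity), min_le_left _ _,
        (min_le_right _ _).trans_lt (half_lt_self hγ0)⟩
    have hM0 : 0 < (γ : ℝ) - θ := by linarith
    have hMI : (γ : ℝ) - θ ∈ orliczInterval (γ : ℝ≥0∞) := by
      refine ⟨hM0.le, ?_⟩
      rw [← ENNReal.ofReal_coe_nnreal]
      exact (ENNReal.ofReal_lt_ofReal_iff hγ0).2 (by linarith)
    refine ⟨γ - θ, hMI, hM0, fun g h hg hhg hgh hz hgM => ?_⟩
    have hgMt : g (γ - θ) ≠ ∞ := by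
      intro hT
      rw [hT, ENNReal.top_mul (weightIntegral_ne_zero w hMI hM0)] at hgM
      simp at hgM
    have hred : ∀ f : ℝ → ℝ≥0∞, (∀ t, f t ≤ g t) →
        ∫⁻ t in Ici ((γ : ℝ) - θ), (f t - s) = ∫⁻ t in Ico ((γ : ℝ) - θ) γ, (f t - s) := by
      intro f hf
      rw [← Ico_union_Ici_eq_Ici (by linarith : (γ : ℝ) - θ ≤ γ),
        lintegral_union measurableSet_Ici
          (disjoint_left.2 fun t ht ht' => absurd ht.2 (not_lt.2 ht')),
        setLIntegral_congr_fun (g := fun _ => 0) (s := Ici (γ : ℝ)) measurableSet_Ici fun t ht =>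
          tsub_eq_zero_of_le ?_, lintegral_zero, add_zero]
      refine (hf t).trans ?_
      rw [hz t (by rw [← ENNReal.ofReal_coe_nnreal]; exact ENNReal.ofReal_le_ofReal ht)]
      exact zero_le
    have hvol : volume (Ico ((γ : ℝ) - θ) γ) = ENNReal.ofReal θ := by
      rw [Real.volume_Ico]; congr 1; ring
    rw [hred h hhg, hred g fun _ => le_rfl]
    constructor
    · refine ne_top_of_le_ne_top (ENNReal.mul_ne_top hgMt (ENNReal.ofReal_ne_top (r := θ))) ?_
      rw [← hvol, ← setLIntegral_const]
      exact setLIntegral_mono' measurableSet_Ico fun t ht =>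
        tsub_le_self.trans ((hhg t).trans (hg ht.1))
    · calc ∫⁻ t in Ico ((γ : ℝ) - θ) γ, (g t - s)
          ≤ ∫⁻ t in Ico ((γ : ℝ) - θ) γ, ((h t - s) + η) := by
            refine lintegral_mono fun t => tsub_le_iff_right.2 ((hgh t).trans ?_)
            rw [add_right_comm]
            exact add_le_add_left le_tsub_add _
        _ = (∫⁻ t in Ico ((γ : ℝ) - θ) γ, (h t - s)) + η * ENNReal.ofReal θ := by
            rw [lintegral_add_right _ measurable_const, setLIntegral_const, hvol]
        _ ≤ _ := by
            refine add_le_add_right ?_ _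
            refine (mul_le_mul_right (ENNReal.ofReal_le_ofReal hθe) _).trans (le_of_eq ?_)
            have : (e : ℝ) / 4 = ((e / 4 : ℝ≥0) : ℝ) := by push_cast; ring
            rw [this, ENNReal.ofReal_coe_nnreal, ← ENNReal.coe_mul, hκ, hs]
            congr 1
            rw [← NNReal.coe_inj]
            push_cast
            ring

end Weight

/-! ### Norm and modular -/

section NonSquare

variable {γ : ℝ≥0∞} (φ : OrliczFunction) (w : WeightFunction γ)

theorem OrliczFunction.ext_enorm (r : ℝ) : φ.ext ‖r‖ₑ = φ.toFun ‖r‖₊ := φ.ext_coe ‖r‖₊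

theorem orliczMeasure_Ioo {t : ℝ} (ht : t ∈ orliczInterval γ) :
    orliczMeasure γ (Ioo 0 t) = ENNReal.ofReal t := by
  rw [orliczMeasure, Measure.restrict_apply measurableSet_Ioo,
    inter_eq_self_of_subset_left (Ioo_subset_orliczInterval ht), Real.volume_Ioo, sub_zero]

theorem lorentzFunctional_indicator_const {t : ℝ} (ht : t ∈ orliczInterval γ) {c : ℝ≥0∞}
    (hc : c ≠ ∞) :
    lorentzFunctional w ((Ioo 0 t).indicator fun _ => c) = c * weightIntegral w t := by
  have h1 : ∀ s ∈ orliczInterval γ,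
      decRearr (orliczMeasure γ) ((Ioo 0 t).indicator fun _ => c) (ENNReal.ofReal s) *
        ENNReal.ofReal (w.toFun s) =
      (Iio t).indicator (fun s => c * ENNReal.ofReal (w.toFun s)) s := by
    intro s hs
    rw [decRearr_indicator_const, orliczMeasure_Ioo ht]
    by_cases hst : s < t
    · rw [if_pos ((ENNReal.ofReal_lt_ofReal_iff (hs.1.trans_lt hst)).2 hst),
        indicator_of_mem (show s ∈ Iio t from hst)]
    · rw [if_neg (not_lt.2 (ENNReal.ofReal_le_ofReal (not_lt.1 hst))),
        indicator_of_notMem (show s ∉ Iio t from hst), zero_mul]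
  have h2 : Iio t ∩ orliczInterval γ = Ico 0 t := by
    ext s
    exact ⟨fun h => ⟨h.2.1, h.1⟩,
      fun h => ⟨h.2, h.1, (ENNReal.ofReal_le_ofReal h.2.le).trans_lt ht.2⟩⟩
  rw [lorentzFunctional, setLIntegral_congr_fun (measurableSet_orliczInterval γ) h1,
    lintegral_indicator measurableSet_Iio, Measure.restrict_restrict measurableSet_Iio, h2,
    lintegral_const_mul' _ _ hc, weightIntegral, setLIntegral_congr Ioo_ae_eq_Ico]

theorem orliczModular_indicator_const {t : ℝ} (ht : t ∈ orliczInterval γ) (c : ℝ) :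
    orliczModular φ w ((Ioo 0 t).indicator fun _ => c) =
      φ.toFun ‖c‖₊ * weightIntegral w t := by
  rw [orliczModular_eq_lorentzFunctional, ← lorentzFunctional_indicator_const w ht
    ENNReal.coe_ne_top]
  congr 1
  funext s
  by_cases hs : s ∈ Ioo 0 t
  · rw [indicator_of_mem hs, indicator_of_mem hs, φ.ext_enorm]
  · rw [indicator_of_notMem hs, indicator_of_notMem hs, enorm_zero, φ.ext_zero]

theorem OrliczLorentz.norm_le_of_orliczModular_le {f : OrliczLorentz φ w} {ε : ℝ} (hε : 0 < ε)
    (h : orliczModular φ w (fun x => ε⁻¹ * f.1 x) ≤ 1) : ‖f‖ ≤ ε :=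
  csInf_le ⟨0, fun _ hr => hr.1.le⟩ ⟨hε, by simpa only [div_eq_inv_mul] using h⟩

theorem OrliczLorentz.exists_orliczModular_le_of_norm_lt {f : OrliczLorentz φ w} {r : ℝ}
    (h : ‖f‖ < r) : ∃ ε, 0 < ε ∧ ε < r ∧ orliczModular φ w (fun x => ε⁻¹ * f.1 x) ≤ 1 := by
  -- The real infimum of the empty set is `0`, so `‖f‖ < r` yields an admissible `ε` only after the
  -- set is known to be nonempty.
  have hne : {ε : ℝ | 0 < ε ∧ orliczModular φ w (fun x => f.1 x / ε) ≤ 1}.Nonempty := by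
    by_contra hc
    obtain ⟨b, hb0, _, hb⟩ := exists_lt_of_gauge_lt (OrliczLorentz.absorbent_unitBall φ w)
      (lt_add_one (gauge {g : OrliczLorentz φ w | orliczModular φ w g.1 ≤ 1} f))
    obtain ⟨g, hg, hgf⟩ := hb
    refine hc ⟨b, hb0, ?_⟩
    have hbg : b • g = f := hgf
    simp only [div_eq_inv_mul]
    rw [← orliczModular_coe_smul, ← hbg, inv_smul_smul₀ hb0.ne']
    exact hg
  obtain ⟨ε, ⟨hε0, hε⟩, hεr⟩ := exists_lt_of_csInf_lt hne h
  exact ⟨ε, hε0, hεr, by simpa only [div_eq_inv_mul] using hε⟩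

/-- With `‖f‖ < 1` strict, an admissible `ε < 1` exists, and no semicontinuity of the modular is
needed. -/
theorem OrliczLorentz.orliczModular_le_one {f : OrliczLorentz φ w} (h : ‖f‖ < 1) :
    orliczModular φ w f.1 ≤ 1 := by
  obtain ⟨ε, hε0, hε1, hε⟩ := OrliczLorentz.exists_orliczModular_le_of_norm_lt φ w h
  refine le_trans ?_ hε
  simpa using orliczModular_smul_le φ w f.1 (c := 1) (d := ε⁻¹) (by
    rw [abs_one, abs_of_pos (inv_pos.2 hε0)]
    exact (one_le_inv₀ hε0).2 hε1.le)

/-! ### A uniformly non-square point -/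

/-- At `a = b = 1/2` the two inequalities read `φ(d/2) + η ≤ φ(d)/2` and `1 ≤ 1 + l`. Both are
strict there, so by continuity of `φ` they persist for `b` slightly larger than `1/2` and `a = 1 -
b`. -/
theorem exists_convex_coefficients {c d η l : ℝ≥0}
    (hη : φ.toFun (d / 2) + η < φ.toFun d / 2) (hc : φ.toFun d * c = 1) (hl : 0 < l) :
    ∃ a b : ℝ≥0, a + b = 1 ∧ 0 < a ∧ 1 / 2 < b ∧ b < 1 ∧
      φ.toFun (b * d) + η ≤ a * φ.toFun (b / a * d) ∧
      a * (φ.toFun (b / a * d) * c) + b ≤ 1 + l := by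
  have hhalf : (1 : ℝ≥0) - 1 / 2 = 1 / 2 := by
    refine tsub_eq_of_eq_add ?_
    exact (add_halves 1).symm
  have hca : ContinuousAt (fun b : ℝ≥0 => 1 - b) (1 / 2) :=
    (continuous_const.sub continuous_id).continuousAt
  have hcq : ContinuousAt (fun b : ℝ≥0 => φ.toFun (b / (1 - b) * d)) (1 / 2) :=
    φ.continuous.continuousAt.comp
      ((continuousAt_id.div₀ hca (by rw [hhalf]; exact (half_pos one_pos).ne')).mul
        continuousAt_const)
  have hcb : ContinuousAt (fun b : ℝ≥0 => φ.toFun (b * d)) (1 / 2) :=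
    (φ.continuous.comp (continuous_id.mul continuous_const)).continuousAt
  have hq : (1 / 2 : ℝ≥0) / (1 - 1 / 2) * d = d := by
    rw [hhalf, div_self (half_pos one_pos).ne', one_mul]
  have h1 : ∀ᶠ b in 𝓝 (1 / 2 : ℝ≥0),
      φ.toFun (b * d) + η < (1 - b) * φ.toFun (b / (1 - b) * d) := by
    refine (hcb.add continuousAt_const).eventually_lt (hca.mul hcq) ?_
    simp only [Pi.add_apply]
    rw [hq, hhalf]
    simpa only [one_div, inv_mul_eq_div] using hη
  have h2 : ∀ᶠ b in 𝓝 (1 / 2 : ℝ≥0),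
      (1 - b) * (φ.toFun (b / (1 - b) * d) * c) + b < 1 + l := by
    refine ((hca.mul (hcq.mul continuousAt_const)).add continuousAt_id).eventually_lt
      continuousAt_const ?_
    simp only [Pi.add_apply, Pi.mul_apply, id]
    rw [hq, hhalf, hc, mul_one, add_halves]
    exact lt_add_of_pos_right _ hl
  have h3 : ∀ᶠ b in 𝓝 (1 / 2 : ℝ≥0), b < 1 := eventually_lt_nhds (half_lt_self one_pos)
  have hne : (𝓝[>] (1 / 2 : ℝ≥0)).NeBot := nhdsGT_neBot _
  obtain ⟨b, ⟨hb1, hb2, hb3⟩, hb⟩ :=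
    (((h1.and (h2.and h3)).filter_mono nhdsWithin_le_nhds).and
      (self_mem_nhdsWithin : Ioi (1 / 2 : ℝ≥0) ∈ 𝓝[>] (1 / 2 : ℝ≥0))).exists
  exact ⟨1 - b, b, tsub_add_cancel_of_le hb3.le, tsub_pos_of_lt hb3, hb, hb3, hb1.le, hb2.le⟩

/-- The pointwise estimate behind the uniform non-squareness. -/
theorem OrliczFunction.map_abs_sub_add_le {a b η d : ℝ≥0} (hb : b ≤ 1)
    (h : φ.toFun (b * d) + η ≤ a * φ.toFun (b / a * d)) {y : ℝ} (hy : 0 ≤ y) :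
    φ.toFun ‖(b : ℝ) * (d - y)‖₊ + η ≤ a * φ.toFun (b / a * d) + b * φ.toFun ‖y‖₊ := by
  lift y to ℝ≥0 using hy
  have hyn : ‖(y : ℝ)‖₊ = y := by simp
  rw [hyn]
  -- As `y ≥ 0`, the distance `|d - y|` is at most the larger of `d` and `y`. If `d` is larger, the
  -- gap `η` comes from `h`. If `y` is larger, `b φ(y)` alone dominates and the term with `a` pays
  -- for `η`.
  rcases le_total y d with hyd | hyd
  · have h1 : ‖(b : ℝ) * (d - y)‖₊ ≤ b * d := by
      rw [← NNReal.coe_le_coe, coe_nnnorm, Real.norm_eq_abs, abs_mul, NNReal.abs_eq]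
      push_cast
      refine mul_le_mul_of_nonneg_left ?_ b.2
      rw [abs_of_nonneg (sub_nonneg.2 (by exact_mod_cast hyd))]
      exact sub_le_self _ y.2
    exact ((add_le_add_left (φ.mono h1) η).trans h).trans (le_add_of_nonneg_right zero_le)
  · have h1 : ‖(b : ℝ) * (d - y)‖₊ ≤ b * y := by
      rw [← NNReal.coe_le_coe, coe_nnnorm, Real.norm_eq_abs, abs_mul, NNReal.abs_eq]
      push_cast
      refine mul_le_mul_of_nonneg_left ?_ b.2
      rw [abs_sub_comm, abs_of_nonneg (sub_nonneg.2 (by exact_mod_cast hyd))]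
      exact sub_le_self _ d.2
    rw [add_comm]
    exact add_le_add ((le_add_of_nonneg_left zero_le).trans h)
      ((φ.mono h1).trans (φ.map_mul_le hb y))

/-- The scaling factor `b > 1/2` is uniform in `y`; the conclusion says that `x - y` has norm at
most `1/b < 2`. -/
theorem exists_orliczModular_sub_le_one (hγ : 0 < γ) {t : ℝ} (ht : t ∈ orliczInterval γ)
    (ht0 : 0 < t) {d : ℝ≥0} (hd : φ.toFun (d / 2) < φ.toFun d / 2)
    (hdt : φ.toFun d * weightIntegral w t = 1) :
    ∃ b : ℝ≥0, 1 / 2 < b ∧ b < 1 ∧ ∀ y : ℝ → ℝ, Measurable y → orliczModular φ w y ≤ 1 →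
      ENNReal.ofReal (t / 2) ≤ orliczMeasure γ (Ioo 0 t ∩ {s | 0 ≤ y s}) →
      orliczModular φ w (fun s => b * ((Ioo 0 t).indicator (fun _ => (d : ℝ)) s - y s)) ≤ 1 := by
  obtain ⟨η, hη0, hη⟩ : ∃ η, 0 < η ∧ φ.toFun (d / 2) + η < φ.toFun d / 2 := by
    obtain ⟨r, hr1, hr2⟩ := exists_between hd
    exact ⟨r - φ.toFun (d / 2), tsub_pos_of_lt hr1, by rwa [add_tsub_cancel_of_le hr1.le]⟩
  -- The gain `l` depends only on `η` and `t` (besides the weight), so `b` may be chosen after it,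
  -- close enough to `1/2` for the excess to be at most `l`. The minimum with `1` keeps the
  -- functional at `G` below `2`, as the uniform gain requires.
  obtain ⟨l, hl0, hl⟩ := exists_lorentzFunctional_add_le w hγ hη0 (e := (t / 2).toNNReal)
    (Real.toNNReal_pos.2 (half_pos ht0))
  obtain ⟨c, hc⟩ : ∃ c : ℝ≥0, (c : ℝ≥0∞) = weightIntegral w t :=
    ⟨_, ENNReal.coe_toNNReal (weightIntegral_ne_top w ht)⟩
  rw [← hc] at hdt
  obtain ⟨a, b, hab, ha0, hb, hb1, hφ, hle⟩ := exists_convex_coefficients φ hη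
    (c := c) (by exact_mod_cast hdt) (lt_min hl0 one_pos : 0 < min l 1)
  refine ⟨b, hb, hb1, fun y hy hy1 hE => ?_⟩
  set μd : ℝ≥0 := b / a * d with hμd
  have haμ : a * μd = b * d := by
    rw [hμd, ← mul_assoc, mul_div_cancel₀ _ ha0.ne']
  set A : Set ℝ := Ioo 0 t
  set E : Set ℝ := A ∩ {s | 0 ≤ y s} with hEdef
  have hEm : MeasurableSet E := measurableSet_Ioo.inter (measurableSet_le measurable_const hy)
  set x' : ℝ → ℝ := A.indicator fun _ => (μd : ℝ) with hx'
  have hx'm : Measurable x' := measurable_const.indicator measurableSet_Ioo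
  set X : ℝ → ℝ≥0∞ := fun s => φ.ext ‖x' s‖ₑ
  set Y : ℝ → ℝ≥0∞ := fun s => φ.ext ‖y s‖ₑ
  have hX : Measurable X := φ.ext_measurable.comp hx'm.enorm
  have hY : Measurable Y := φ.ext_measurable.comp hy.enorm
  set G : ℝ → ℝ≥0∞ := fun s => a * X s + b * Y s with hG
  have hGm : Measurable G := (hX.const_mul _).add (hY.const_mul _)
  have hmul : ∀ (r : ℝ≥0) (F : ℝ → ℝ≥0∞),
      lorentzFunctional w (fun s => r * F s) = r * lorentzFunctional w F := by
    intro r F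
    simp only [lorentzFunctional, decRearr_const_mul, mul_assoc]
    exact lintegral_const_mul' _ _ ENNReal.coe_ne_top
  have hΛG : lorentzFunctional w G ≤ (1 + min l 1 : ℝ≥0) := by
    calc lorentzFunctional w G
        ≤ a * lorentzFunctional w X + b * lorentzFunctional w Y := by
          rw [← hmul, ← hmul]
          exact lintegral_decRearr_weight_add_le w (hX.const_mul _).aemeasurable
            (hY.const_mul _).aemeasurable
      _ ≤ a * (φ.toFun μd * c) + b * 1 := by
          refine add_le_add (le_of_eq ?_) (mul_le_mul_right ?_ _)
          · rw [← orliczModular_eq_lorentzFunctional, hx', orliczModular_indicator_const φ w ht,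
              hc]
            congr 4
            simp
          · rwa [← orliczModular_eq_lorentzFunctional]
      _ ≤ _ := by
          rw [mul_one]
          exact_mod_cast hle
  have hpt : ∀ s, s ∈ E → φ.ext ‖(b : ℝ) * (A.indicator (fun _ => (d : ℝ)) s - y s)‖ₑ + η ≤ G s := by
    intro s hs
    have := φ.map_abs_sub_add_le hb1.le hφ (y := y s) hs.2
    simp only [hG, X, Y, hx', indicator_of_mem hs.1, φ.ext_enorm]
    have hn : ‖(μd : ℝ)‖₊ = μd := by simp
    rw [hn]
    exact_mod_cast this
  have hpt' : ∀ s, φ.ext ‖(b : ℝ) * (A.indicator (fun _ => (d : ℝ)) s - y s)‖ₑ ≤ G s := by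
    intro s
    -- With `x' = (b/a) x`, the function `b(x - y)` is the convex combination `a x' + b(-y)`.
    have h1 : (b : ℝ) * (A.indicator (fun _ => (d : ℝ)) s - y s) = a * x' s + b * (-y s) := by
      have haμ' : (a : ℝ) * μd = b * d := by exact_mod_cast haμ
      by_cases hs : s ∈ A
      · simp only [hx', indicator_of_mem hs, haμ']; ring
      · simp only [hx', indicator_of_notMem hs]; ring
    rw [h1]
    refine (φ.ext_mono (enorm_add_le _ _)).trans ?_
    simp only [enorm_mul, enorm_neg]
    have hn : ∀ r : ℝ≥0, ‖(r : ℝ)‖ₑ = r := fun r => by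
      rw [Real.enorm_eq_ofReal (NNReal.coe_nonneg r), ENNReal.ofReal_coe_nnreal]
    rw [hn, hn]
    exact φ.ext_convex _ _ hab
  have h2 : lorentzFunctional w G ≤ 2 := by
    refine hΛG.trans ?_
    have : 1 + min l 1 ≤ (2 : ℝ≥0) := by
      rw [← one_add_one_eq_two]
      exact add_le_add_right (min_le_right _ _) _
    exact_mod_cast this
  have h3 := hl G hGm.aemeasurable E hEm hE
    (fun s hs => (le_add_of_nonneg_left zero_le).trans (hpt s hs)) h2
  have h4 : lorentzFunctional w (fun s => G s - E.indicator (fun _ => (η : ℝ≥0∞)) s) ≤ 1 := by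
    refine (ENNReal.add_le_add_iff_right (ENNReal.coe_ne_top (r := l))).1
      (h3.trans (hΛG.trans ?_))
    have : 1 + min l 1 ≤ 1 + l := add_le_add_right (min_le_left _ _) _
    exact_mod_cast this
  rw [orliczModular_eq_lorentzFunctional]
  refine le_trans (lintegral_mono fun s => mul_le_mul_left
    (decRearr_mono _ (ae_of_all _ fun s => ?_) _) _) h4
  by_cases hs : s ∈ E
  · simp only [indicator_of_mem hs]
    exact ENNReal.le_sub_of_add_le_right ENNReal.coe_ne_top (hpt s hs)
  · simp only [indicator_of_notMem hs, tsub_zero]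
    exact hpt' s

/-- Absolute continuity of the integral: `∫_0^t w → 0` as `t → 0`. Taking `c = φ(D)` lets the height
`d` with `φ(d) ∫_0^t w = 1` be found at or beyond `D`. -/
theorem exists_weightIntegral_mul_le_one (hγ : 0 < γ) (c : ℝ≥0) :
    ∃ t ∈ orliczInterval γ, 0 < t ∧ c * weightIntegral w t ≤ 1 := by
  obtain ⟨T, hT0, hT⟩ : ∃ T : ℝ, 0 < T ∧ T ∈ orliczInterval γ := by
    obtain ⟨r, hr0, hr⟩ := exists_between hγ
    lift r to ℝ≥0 using hr.ne_top
    exact ⟨r, by exact_mod_cast hr0, r.2, by rwa [ENNReal.ofReal_coe_nnreal]⟩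
  have hlim : Tendsto (fun n : ℕ => ∫⁻ s in Ioo 0 (T / (n + 1)), ENNReal.ofReal (w.toFun s)
      ∂volume.restrict (Ioo 0 T)) atTop (𝓝 0) := by
    refine tendsto_setLIntegral_zero (weightIntegral_ne_top w hT) ?_
    have h1 : Tendsto (fun n : ℕ => ENNReal.ofReal (T / (n + 1))) atTop (𝓝 0) := by
      rw [← ENNReal.ofReal_zero]
      exact ENNReal.tendsto_ofReal (by
        simpa [div_eq_mul_inv] using (tendsto_one_div_add_atTop_nhds_zero_nat (𝕜 := ℝ)).const_mul T)
    refine tendsto_of_tendsto_of_tendsto_of_le_of_le tendsto_const_nhds h1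
      (fun _ => zero_le) fun n => ?_
    refine (Measure.restrict_apply_le _ _).trans ?_
    rw [Real.volume_Ioo, sub_zero]
  have hmul := ENNReal.Tendsto.const_mul (a := (c : ℝ≥0∞)) hlim (Or.inr ENNReal.coe_ne_top)
  rw [mul_zero] at hmul
  obtain ⟨n, hn⟩ := (hmul.eventually (gt_mem_nhds one_pos)).exists
  have hnT : T / (n + 1) ≤ T := div_le_self hT0.le (by simp)
  refine ⟨T / (n + 1), ⟨by positivity, (ENNReal.ofReal_le_ofReal hnT).trans_lt hT.2⟩,
    by positivity, ?_⟩
  rw [Measure.restrict_restrict measurableSet_Ioo,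
    inter_eq_self_of_subset_left (Ioo_subset_Ioo_right hnT)] at hn
  exact hn.le

/-- If `φ` is not linear, the unit sphere contains a uniformly non-`ℓ₁²` point. -/
theorem OrliczLorentz.exists_norm_add_le_or_norm_sub_le (hγ : 0 < γ)
    (h : ¬ ∃ k : ℝ≥0, 0 < k ∧ ∀ u : ℝ≥0, φ.toFun u = k * u) :
    ∃ x : OrliczLorentz φ w, ‖x‖ = 1 ∧ ∃ δ : ℝ, 0 < δ ∧
      ∀ y : OrliczLorentz φ w, ‖y‖ ≤ 1 → ‖x + y‖ ≤ 2 - δ ∨ ‖x - y‖ ≤ 2 - δ := by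
  obtain ⟨D, hD⟩ := φ.exists_forall_half_lt h
  obtain ⟨t, ht, ht0, htD⟩ := exists_weightIntegral_mul_le_one w hγ (φ.toFun D)
  obtain ⟨d, hd, hdt⟩ : ∃ d, φ.toFun (d / 2) < φ.toFun d / 2 ∧
      φ.toFun d * weightIntegral w t = 1 := by
    obtain ⟨c, hc⟩ : ∃ c : ℝ≥0, (c : ℝ≥0∞) = weightIntegral w t :=
      ⟨_, ENNReal.coe_toNNReal (weightIntegral_ne_top w ht)⟩
    have hc0 : c ≠ 0 := by
      rintro rfl
      exact weightIntegral_ne_zero w ht ht0 (by simpa using hc.symm)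
    rw [← hc] at htD ⊢
    have htD' : φ.toFun D ≤ c⁻¹ := (NNReal.le_inv_iff_mul_le hc0).2 (by exact_mod_cast htD)
    obtain ⟨v, hv⟩ := φ.exists_forall_lt c⁻¹
    -- The value `1/c`, where `c = ∫_0^t w`, lies between `φ(D)` and `φ(max D v)`, so continuity of
    -- `φ` gives `d ≥ D` attaining it.
    obtain ⟨d, hd, hdc⟩ := intermediate_value_Icc (le_max_left D v) φ.continuous.continuousOn
      ⟨htD', (hv _ (le_max_right D v)).le⟩
    refine ⟨d, hD d hd.1, ?_⟩
    rw [hdc, ← ENNReal.coe_mul, inv_mul_cancel₀ hc0, ENNReal.coe_one]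
  obtain ⟨b, hb, hb1, hbt⟩ := exists_orliczModular_sub_le_one φ w hγ ht ht0 hd hdt
  set x₀ : ℝ → ℝ := (Ioo 0 t).indicator fun _ => (d : ℝ) with hx₀
  have hx₀m : Measurable x₀ := measurable_const.indicator measurableSet_Ioo
  have hmk := AEEqFun.coeFn_mk x₀ (hx₀m.aestronglyMeasurable (μ := orliczMeasure γ))
  have hmod : ∀ r : ℝ≥0, orliczModular φ w (fun s => r * x₀ s) =
      φ.toFun (r * d) * weightIntegral w t := by
    intro r
    have h1 : (fun s => (r : ℝ) * x₀ s) = (Ioo 0 t).indicator fun _ => ((r * d : ℝ≥0) : ℝ) := by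
      funext s
      by_cases hs : s ∈ Ioo 0 t
      · simp [hx₀, indicator_of_mem hs]
      · simp [hx₀, indicator_of_notMem hs]
    rw [h1, orliczModular_indicator_const φ w ht]
    congr 3
    simp
  have hmodx : ∀ r : ℝ≥0, orliczModular φ w
      (fun s => r * AEEqFun.mk x₀ (hx₀m.aestronglyMeasurable (μ := orliczMeasure γ)) s) =
      φ.toFun (r * d) * weightIntegral w t := by
    intro r
    rw [← hmod]
    refine orliczModular_congr φ w ?_
    filter_upwards [hmk] with s hs
    rw [hs]
  set x : OrliczLorentz φ w := ⟨AEEqFun.mk x₀ hx₀m.aestronglyMeasurable, 1, one_pos, by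
    have := hmodx 1
    rw [one_mul, hdt] at this
    rw [NNReal.coe_one] at this
    rw [this]
    exact ENNReal.one_lt_top⟩ with hx
  have hx1 : ‖x‖ = 1 := by
    refine le_antisymm (OrliczLorentz.norm_le_of_orliczModular_le φ w one_pos ?_) ?_
    · have := hmodx 1
      rw [one_mul, hdt, NNReal.coe_one] at this
      rw [inv_one]
      exact this.le
    -- If `ρ(x/ε) ≤ 1 = ρ(x)` with `ε < 1`, then `φ(d/ε) ≤ φ(d)`. Convexity gives `φ(d) ≤ ε φ(d/ε)`,
    -- which is impossible as `φ(d) > 0`.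
    · by_contra! hc
      obtain ⟨ε, hε0, hε1, hε⟩ := OrliczLorentz.exists_orliczModular_le_of_norm_lt φ w hc
      lift ε to ℝ≥0 using hε0.le
      have hε0' : 0 < ε := by exact_mod_cast hε0
      have hε1' : ε < 1 := by exact_mod_cast hε1
      rw [← NNReal.coe_inv] at hε
      rw [show orliczModular φ w (fun s => ((ε⁻¹ : ℝ≥0) : ℝ) * x.1 s) = _ from hmodx ε⁻¹,
        ← hdt] at hε
      have h1 : φ.toFun (ε⁻¹ * d) ≤ φ.toFun d := by
        have := (ENNReal.mul_le_mul_iff_left (weightIntegral_ne_zero w ht ht0)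
          (weightIntegral_ne_top w ht)).1 hε
        exact_mod_cast this
      have h2 := φ.map_mul_le hε1'.le (ε⁻¹ * d)
      rw [mul_inv_cancel_left₀ hε0'.ne'] at h2
      have h3 : φ.toFun d ≠ 0 := by
        intro h0
        rw [h0] at hdt
        simp at hdt
      have h4 : ε * φ.toFun (ε⁻¹ * d) ≤ ε * φ.toFun d := mul_le_mul_right h1 ε
      have h5 : ε * φ.toFun d < 1 * φ.toFun d := mul_lt_mul_of_pos_right hε1' (pos_iff_ne_zero.2 h3)
      rw [one_mul] at h5
      exact absurd (h2.trans h4) (not_le.2 h5)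
  have hbR : (1 / 2 : ℝ) < b := by exact_mod_cast hb
  have hb1R : (b : ℝ) < 1 := by exact_mod_cast hb1
  have hb0R : (0 : ℝ) < b := lt_trans (by norm_num) hbR
  obtain ⟨δ, hδ⟩ : ∃ δ : ℝ, δ = 2 - (b : ℝ)⁻¹ := ⟨_, rfl⟩
  have hδ0 : 0 < δ := by
    have : (b : ℝ)⁻¹ < 2 := by
      rw [inv_lt_comm₀ hb0R two_pos]
      simpa using hbR
    linarith
  have hδ1 : δ < 1 := by
    have : 1 < (b : ℝ)⁻¹ := (one_lt_inv₀ hb0R).2 hb1R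
    linarith
  refine ⟨x, hx1, δ / 2, half_pos hδ0, fun y hy => ?_⟩
  -- Shrinking `y` makes its norm strictly less than `1`, hence `ρ(z) ≤ 1`. The cost `δ/2` is half
  -- of the room `δ = 2 - 1/b`.
  set z : OrliczLorentz φ w := (1 - δ / 2) • y with hz
  have hz1 : ‖z‖ < 1 := by
    rw [hz, norm_smul, Real.norm_of_nonneg (by linarith)]
    nlinarith
  have hyz : ‖y - z‖ ≤ δ / 2 := by
    have h1 : y - z = (δ / 2) • y := by rw [hz, sub_smul, one_smul, sub_sub_cancel]
    rw [h1, norm_smul, Real.norm_of_nonneg (by linarith)]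
    nlinarith
  have hzρ := OrliczLorentz.orliczModular_le_one φ w hz1
  have hzm : Measurable (z.1 : ℝ → ℝ) := (AEEqFun.stronglyMeasurable z.1).measurable
  suffices hxz : ‖x + z‖ ≤ (b : ℝ)⁻¹ ∨ ‖x - z‖ ≤ (b : ℝ)⁻¹ by
    refine hxz.imp (fun h1 => ?_) fun h1 => ?_
    · have h2 : x + y = (x + z) + (y - z) := by abel
      have h3 := norm_add_le (x + z) (y - z)
      rw [h2]
      linarith
    · have h2 : x - y = (x - z) - (y - z) := by abel
      have h3 := norm_sub_le (x - z) (y - z)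
      rw [h2]
      linarith
  -- The sets where `z ≤ 0` and `z ≥ 0` cover `(0, t)`, so one of them fills at least half of it.
  -- The sign decides between `x + z` and `x - z`.
  have hcover : ENNReal.ofReal (t / 2) ≤ orliczMeasure γ (Ioo 0 t ∩ {s | 0 ≤ -z.1 s}) ∨
      ENNReal.ofReal (t / 2) ≤ orliczMeasure γ (Ioo 0 t ∩ {s | 0 ≤ z.1 s}) := by
    by_contra! hc
    refine absurd (ENNReal.add_lt_add hc.1 hc.2) (not_lt.2 ?_)
    rw [← ENNReal.ofReal_add (by positivity) (by positivity), add_halves, ← orliczMeasure_Ioo ht]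
    refine (measure_mono fun s hs => ?_).trans (measure_union_le _ _)
    rcases le_total 0 (z.1 s) with h0 | h0
    · exact Or.inr ⟨hs, h0⟩
    · exact Or.inl ⟨hs, neg_nonneg.2 h0⟩
  refine hcover.imp (fun hE => ?_) fun hE => ?_
  · refine OrliczLorentz.norm_le_of_orliczModular_le φ w (inv_pos.2 hb0R) ?_
    rw [inv_inv]
    refine le_trans (le_of_eq (orliczModular_congr φ w ?_)) (hbt (fun s => -z.1 s) hzm.neg ?_ hE)
    · filter_upwards [hmk, AEEqFun.coeFn_add x.1 z.1] with s hs hs'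
      rw [show (x + z).1 s = x.1 s + z.1 s from hs', show x.1 s = x₀ s from hs, sub_neg_eq_add]
    · refine le_trans (orliczModular_mono φ w (ae_of_all _ fun s => ?_)) hzρ
      rw [abs_neg]
  · refine OrliczLorentz.norm_le_of_orliczModular_le φ w (inv_pos.2 hb0R) ?_
    rw [inv_inv]
    refine le_trans (le_of_eq (orliczModular_congr φ w ?_)) (hbt (fun s => z.1 s) hzm hzρ hE)
    filter_upwards [hmk, AEEqFun.coeFn_sub x.1 z.1] with s hs hs'
    rw [show (x - z).1 s = x.1 s - z.1 s from hs', show x.1 s = x₀ s from hs]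

end NonSquare

/-! ### Linearity of the Orlicz function -/

theorem mainTheorem7 {γ : ℝ≥0∞} (hγ : 0 < γ) (φ : OrliczFunction) (w : WeightFunction γ)
    (h : HasDLD2P (OrliczLorentz φ w) ∨ HasDD2P (OrliczLorentz φ w) ∨
      HasDaugavetProperty (OrliczLorentz φ w)) :
    ∃ k : ℝ≥0, 0 < k ∧ ∀ u : ℝ≥0, φ.toFun u = k * u := by
  by_contra hφ
  obtain ⟨x, hx, δ, hδ, hxy⟩ := OrliczLorentz.exists_norm_add_le_or_norm_sub_le φ w hγ hφ
  refine not_hasDLD2P_of_norm_add_le_or_norm_sub_le hx hδ hxy ?_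
  rcases h with h | h | h
  · exact h
  · exact h.hasDLD2P
  · exact h.hasDLD2P
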